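/- Let $0<l_a\le l_b$ be real numbers. For a nondegenerate triangle $ABC$ in the Euclidean plane, with vertices named $A,B,C$, consider the lengths of its internal angle bisectors (measured from the vertex to the opposite side), of its heights $h_a,h_b,h_c$ and of its medians $m_a,m_b,m_c$ from $A,B,C$ respectively. Put $$c^*=\tfrac12\Bigl(l_a+l_b+\sqrt{l_a^2+l_b^2-l_al_b}\Bigr),\qquad a^*=\frac{c^*}{2c^*/l_b-1},\qquad b^*=\frac{c^*}{2c^*/l_a-1},$$ $$h^{**}=\frac{l_al_b}{\sqrt{l_a^2+l_b^2}},\qquad m_a^*=b^*+\tfrac12a^*,\qquad m_b^*=a^*+\tfrac12b^*,\qquad m_c^*=\tfrac12(a^*-b^*).$$ Count, up to congruence, the triangles whose bisectors from $A$ and $B$ have lengths $l_a$ and $l_b$ and in which one further element has a prescribed real value $x$. Here "exactly one" means that there is such a triangle and that any two of them are congruent with $A,B,C$ corresponding to $A,B,C$; "exactly two" means that there are two such triangles that are not congruent under any correspondence of their vertices, and that every other one is congruent to one of these two with $A,B,C$ corresponding to $A,B,C$. 1. $h_a=x$: there are exactly two triangles if $h^{**}<x<l_a$, exactly one if $0<x\le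 h^{**}$ or $x=l_a$, and none if $x\le 0$ or $x>l_a$. 2. $h_b=x$: there are exactly two triangles if $h^{**}<x<l_b$, exactly one if $0<x\le h^{**}$ or $x=l_b$, and none if $x\le 0$ or $x>l_b$. 3. $h_c=x$: there is exactly one triangle if $x>0$, and none if $x\le0$. 4. $m_a=x$: there are exactly two triangles if $l_a<x<m_a^*$, exactly one if $x\ge m_a^*$ or $x=l_a$, and none if $x<l_a$. 5. $m_b=x$: there are exactly two triangles if $l_b<x<m_b^*$, exactly one if $x\ge m_b^*$ or $x=l_b$, and none if $x<l_b$. 6. $m_c=x$: there is exactly one triangle if $x>m_c^*$, and none if $x\le m_c^*$. -/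

import Mathlib

namespace TwoBisectors

/-- Nondegenerate triangles in the Euclidean plane. The vertices `A`, `B`, `C` are the points with
index `0`, `1`, `2`; heights are given by `Affine.Simplex.height`. -/
abbrev PlaneTriangle : Type := Affine.Triangle ℝ (EuclideanSpace ℝ (Fin 2))

/-- `D` is the foot of the internal bisector from vertex `i`: it lies strictly inside the opposite
side, and the line from vertex `i` to `D` halves the angle at vertex `i`. The addition in `Fin 3`
is modulo three, so `i + 1` and `i + 2` are the two other vertices. -/
def IsBisectorFoot (T : PlaneTriangle) (i : Fin 3) (D : EuclideanSpace ℝ (Fin 2)) : Prop :=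
  Sbtw ℝ (T.points (i + 1)) D (T.points (i + 2)) ∧
    EuclideanGeometry.angle (T.points (i + 1)) (T.points i) D =
      EuclideanGeometry.angle D (T.points i) (T.points (i + 2))

/-- The bisector of `T` from vertex `i` has length `l`. -/
def HasBisectorLength (T : PlaneTriangle) (i : Fin 3) (l : ℝ) : Prop :=
  ∃ D, IsBisectorFoot T i D ∧ dist (T.points i) D = l

/-- The length of the median of `T` from vertex `i`. -/
noncomputable def medianLength (T : PlaneTriangle) (i : Fin 3) : ℝ :=
  dist (T.points i) (midpoint ℝ (T.points (i + 1)) (T.points (i + 2)))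

/-- The triangles whose bisectors from `A` and `B` have lengths `la` and `lb`, and in which the
third element `f` has the value `x`. -/
def trianglesWith (la lb : ℝ) (f : PlaneTriangle → ℝ) (x : ℝ) : Set PlaneTriangle :=
  {T | HasBisectorLength T 0 la ∧ HasBisectorLength T 1 lb ∧ f T = x}

/-- Up to congruence, `S` has exactly one triangle (any two triangles of `S` are congruent
with corresponding vertices having the same name). -/
def ExactlyOne (S : Set PlaneTriangle) : Prop :=
  ∃ T₁ ∈ S, ∀ T ∈ S, Congruent T.points T₁.points

/-- Up to congruence, `S` has exactly two triangles: two triangles of `S` are not congruent, even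
if the vertices may be renamed, and every triangle of `S` is congruent to one of the two
with corresponding vertices having the same name. -/
def ExactlyTwo (S : Set PlaneTriangle) : Prop :=
  ∃ T₁ ∈ S, ∃ T₂ ∈ S,
    (∀ σ : Equiv.Perm (Fin 3), ¬ Congruent (T₁.points ∘ σ) T₂.points) ∧
      ∀ T ∈ S, Congruent T.points T₁.points ∨ Congruent T.points T₂.points

/-- `c* = (la + lb + √(la² + lb² - la lb)) / 2`. -/
noncomputable def cStar (la lb : ℝ) : ℝ :=
  (la + lb + Real.sqrt (la ^ 2 + lb ^ 2 - la * lb)) / 2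

/-- `a* = c* / (2 c* / lb - 1)`. -/
noncomputable def aStar (la lb : ℝ) : ℝ :=
  cStar la lb / (2 * cStar la lb / lb - 1)

/-- `b* = c* / (2 c* / la - 1)`. -/
noncomputable def bStar (la lb : ℝ) : ℝ :=
  cStar la lb / (2 * cStar la lb / la - 1)

/-- The common value `h** = la lb / √(la² + lb²)` of `h_a**` and `h_b**`. -/
noncomputable def hStarStar (la lb : ℝ) : ℝ :=
  la * lb / Real.sqrt (la ^ 2 + lb ^ 2)

/-- `m_a* = b* + a* / 2`. -/
noncomputable def maStar (la lb : ℝ) : ℝ :=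
  bStar la lb + aStar la lb / 2

/-- `m_b* = a* + b* / 2`. -/
noncomputable def mbStar (la lb : ℝ) : ℝ :=
  aStar la lb + bStar la lb / 2

/-- `m_c* = (a* - b*) / 2`. -/
noncomputable def mcStar (la lb : ℝ) : ℝ :=
  (aStar la lb - bStar la lb) / 2

end TwoBisectors

/-!
Write `p` for the semiperimeter and put `w = (p - a) / c`, `s = (p - c) / p`. Up to scale a triangle
is a point `(w, s)` of the open unit square. For fixed `s` the ratio of the bisectors from `A` and
`B` increases with `w`, so exactly one `w` and one scale `c` give the lengths `la` and `lb`. The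
triangles with these bisectors thus form a curve parametrized by `s ∈ (0, 1)`, on which `C` tends to
the segment `AB` as `s → 0` and to infinity as `s → 1`.

Along the curve `c` decreases, while `a`, `b` and the half angles at `A` and `B` increase. As `B` is
at most a right angle when `la ≤ lb`, both `h_c = a sin B` and `m_c` increase to infinity. The
height `h_a = la sin (A / 2 + B)` rises from `0` to `la` and then falls to `h**`, since `A / 2 + B`
increases from `0` to a limit beyond `π / 2`. Eliminating `a` gives
`4 m_a ^ 2 = 4 la ^ 2 + (b - c) ^ 2 + la ^ 2 (b - c) ^ 2 / (b c)`, so that `m_a` falls from `m_a*`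
to `la` as long as `b < c` and then rises to infinity. Exchanging `A` and `B` settles `h_b` and
`m_b`.
-/

open Set Filter Topology

namespace TwoBisectors

/-! ### Monotone functions on intervals -/

section OneVariable

lemma continuousOn_of_strictMonoOn_implicit {α β γ : Type*} [TopologicalSpace α]
    [LinearOrder β] [TopologicalSpace β] [OrderTopology β]
    [LinearOrder γ] [TopologicalSpace γ] [OrderClosedTopology γ]
    {S : Set α} {J : Set β} [J.OrdConnected] {G : β → α → γ} {f : α → β} {z : γ}
    (hG : ∀ y ∈ J, ContinuousOn (G y) S) (hmono : ∀ s ∈ S, StrictMonoOn (G · s) J)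
    (hfJ : MapsTo f S J) (hf : ∀ s ∈ S, G (f s) s = z) : ContinuousOn f S := by
  intro s₀ hs₀
  refine tendsto_order.2 ⟨fun y hy => ?_, fun y hy => ?_⟩
  · by_cases hyJ : y ∈ J
    · have hlt : G y s₀ < z := hf s₀ hs₀ ▸ hmono s₀ hs₀ hyJ (hfJ hs₀) hy
      filter_upwards [(hG y hyJ s₀ hs₀).eventually_lt_const hlt, self_mem_nhdsWithin] with s hs hsS
      exact (hmono s hsS).lt_iff_lt hyJ (hfJ hsS) |>.1 (hs.trans_eq (hf s hsS).symm)
    · filter_upwards [self_mem_nhdsWithin] with s hsS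
      exact lt_of_not_ge fun hle => hyJ (OrdConnected.out ‹_› (hfJ hsS) (hfJ hs₀) ⟨hle, hy.le⟩)
  · by_cases hyJ : y ∈ J
    · have hlt : z < G y s₀ := hf s₀ hs₀ ▸ hmono s₀ hs₀ (hfJ hs₀) hyJ hy
      filter_upwards [(hG y hyJ s₀ hs₀).eventually_const_lt hlt, self_mem_nhdsWithin] with s hs hsS
      exact (hmono s hsS).lt_iff_lt (hfJ hsS) hyJ |>.1 ((hf s hsS).trans_lt hs)
    · filter_upwards [self_mem_nhdsWithin] with s hsS
      exact lt_of_not_ge fun hle => hyJ (OrdConnected.out ‹_› (hfJ hs₀) (hfJ hsS) ⟨hy.le, hle⟩)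

lemma tendsto_nhdsLT_of_continuousOn_Icc {α β : Type*} [LinearOrder α] [TopologicalSpace α]
    [OrderTopology α] [TopologicalSpace β] {f : α → β} {a b : α} (hab : a < b)
    (hf : ContinuousOn f (Icc a b)) : Tendsto f (𝓝[<] b) (𝓝 (f b)) := by
  rw [← nhdsWithin_Ico_eq_nhdsLT hab]
  exact (hf b (right_mem_Icc.2 hab.le)).mono Ico_subset_Icc_self

lemma encard_inter_preimage_singleton {α β : Type*} {F : α → β} {S : Set α} (hF : InjOn F S)
    (x : β) : (S ∩ F ⁻¹' {x}).encard = (F '' S).indicator 1 x := by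
  rw [← (hF.mono inter_subset_left).encard_image, image_inter_preimage]
  by_cases hx : x ∈ F '' S
  · rw [inter_eq_right.2 (singleton_subset_iff.2 hx), encard_singleton, indicator_of_mem hx,
      Pi.one_apply]
  · rw [inter_singleton_eq_empty.2 hx, encard_empty, indicator_of_notMem hx]

lemma encard_Ioo_inter_preimage_singleton {α β : Type*} [LinearOrder α] {F : α → β} {a m b : α}
    (hm : m ∈ Ioo a b) (hleft : InjOn F (Ioo a m)) (hright : InjOn F (Ico m b)) (x : β) :
    (Ioo a b ∩ F ⁻¹' {x}).encard =
      (F '' Ioo a m).indicator 1 x + (F '' Ico m b).indicator 1 x := by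
  have hdisj : Disjoint (Ioo a m) (Ico m b) :=
    disjoint_left.2 fun _ hl hr => hr.1.not_gt hl.2
  rw [← Ioo_union_Ico_eq_Ioo hm.1 hm.2.le, union_inter_distrib_right,
    encard_union_eq (hdisj.mono inter_subset_left inter_subset_left),
    encard_inter_preimage_singleton hleft, encard_inter_preimage_singleton hright]

variable {α δ : Type*} [ConditionallyCompleteLinearOrder α] [TopologicalSpace α] [OrderTopology α]
  [DenselyOrdered α] [LinearOrder δ] [TopologicalSpace δ] [OrderClosedTopology δ]
  {F : α → δ} {a m b : α}

lemma image_Ico_of_strictMonoOn_of_tendsto_atTop (hab : a < b) (hF : ContinuousOn F (Ico a b))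
    (hmono : StrictMonoOn F (Ico a b)) (htop : Tendsto F (𝓝[<] b) atTop) :
    F '' Ico a b = Ici (F a) := by
  have ha : a ∈ Ico a b := left_mem_Ico.2 hab
  have : (𝓝[<] b).NeBot := nhdsLT_neBot_of_exists_lt ⟨a, hab⟩
  refine Subset.antisymm ?_ (isPreconnected_Ico.intermediate_value_Ici ha
    (le_principal_iff.2 (Ico_mem_nhdsLT hab)) hF htop)
  rintro _ ⟨s, hs, rfl⟩
  exact hmono.monotoneOn ha hs hs.1

lemma encard_fiber_of_strictMonoOn_strictAntiOn (hm : m ∈ Ioo a b) (hF : ContinuousOn F (Icc a b))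
    (hmono : StrictMonoOn F (Icc a m)) (hanti : StrictAntiOn F (Icc m b)) (x : δ) :
    (Ioo a b ∩ F ⁻¹' {x}).encard =
      (Ioo (F a) (F m)).indicator 1 x + (Ioc (F b) (F m)).indicator 1 x := by
  rw [encard_Ioo_inter_preimage_singleton hm (hmono.injOn.mono Ioo_subset_Icc_self)
      (hanti.injOn.mono Ico_subset_Icc_self),
    (hF.mono (Icc_subset_Icc_right hm.2.le)).image_Ioo_of_strictMonoOn hm.1.le hmono,
    (hF.mono (Icc_subset_Icc_left hm.1.le)).image_Ico_of_strictAntiOn hm.2.le hanti]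

lemma encard_fiber_of_strictAntiOn_strictMonoOn (hm : m ∈ Ioo a b) (hF : ContinuousOn F (Ico a b))
    (hanti : StrictAntiOn F (Icc a m)) (hmono : StrictMonoOn F (Ico m b))
    (htop : Tendsto F (𝓝[<] b) atTop) (x : δ) :
    (Ioo a b ∩ F ⁻¹' {x}).encard =
      (Ioo (F m) (F a)).indicator 1 x + (Ici (F m)).indicator 1 x := by
  rw [encard_Ioo_inter_preimage_singleton hm (hanti.injOn.mono Ioo_subset_Icc_self) hmono.injOn,
    (hF.mono (Icc_subset_Ico_right hm.2)).image_Ioo_of_strictAntiOn hm.1.le hanti,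
    image_Ico_of_strictMonoOn_of_tendsto_atTop hm.2 (hF.mono (Ico_subset_Ico_left hm.1.le))
      hmono htop]

lemma encard_fiber_of_strictMonoOn (hab : a < b) (hF : ContinuousOn F (Ico a b))
    (hmono : StrictMonoOn F (Ico a b)) (htop : Tendsto F (𝓝[<] b) atTop) (x : δ) :
    (Ioo a b ∩ F ⁻¹' {x}).encard = (Ioi (F a)).indicator 1 x := by
  have himage : F '' Ioo a b = Ioi (F a) := by
    rw [← Ico_sdiff_left,
      hmono.injOn.image_sdiff_subset (singleton_subset_iff.2 (left_mem_Ico.2 hab)),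
      image_Ico_of_strictMonoOn_of_tendsto_atTop hab hF hmono htop, image_singleton,
      Ici_sdiff_left]
  rw [encard_inter_preimage_singleton (hmono.injOn.mono Ioo_subset_Ico_self), himage]

end OneVariable

/-! ### Elements of a triangle in terms of its sides -/

section Triangle

variable {V P : Type*} [NormedAddCommGroup V] [InnerProductSpace ℝ V] [MetricSpace P]
  [NormedAddTorsor V P]

lemma dist_lineMap_sq (A P₁ P₂ : P) (t : ℝ) :
    dist A (AffineMap.lineMap P₁ P₂ t) ^ 2 =
      (1 - t) * dist A P₁ ^ 2 + t * dist A P₂ ^ 2 - t * (1 - t) * dist P₁ P₂ ^ 2 := by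
  have hsub : P₁ -ᵥ P₂ = (P₁ -ᵥ A) - (P₂ -ᵥ A) := (vsub_sub_vsub_cancel_right ..).symm
  rw [dist_comm, dist_comm A P₁, dist_comm A P₂, dist_eq_norm_vsub V P₁ P₂, hsub,
    dist_eq_norm_vsub V, AffineMap.lineMap_vsub, AffineMap.lineMap_apply_module,
    dist_eq_norm_vsub V P₁, dist_eq_norm_vsub V P₂, norm_add_sq_real, norm_sub_sq_real,
    norm_smul, norm_smul, mul_pow, mul_pow, Real.norm_eq_abs, Real.norm_eq_abs, sq_abs, sq_abs,
    real_inner_smul_left, real_inner_smul_right]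
  ring

lemma angle_smul_add_smul_eq_iff {x y : V} (hxy : inner ℝ x y < ‖x‖ * ‖y‖) {p q : ℝ}
    (hd : p • x + q • y ≠ 0) :
    InnerProductGeometry.angle x (p • x + q • y) = InnerProductGeometry.angle (p • x + q • y) y ↔
      p * ‖x‖ = q * ‖y‖ := by
  have hx : ‖x‖ ≠ 0 := fun h => by simp [norm_eq_zero.1 h] at hxy
  have hy : ‖y‖ ≠ 0 := fun h => by simp [norm_eq_zero.1 h] at hxy
  have hd' : ‖p • x + q • y‖ ≠ 0 := norm_ne_zero_iff.2 hd
  have hfactor : inner ℝ x (p • x + q • y) * (‖p • x + q • y‖ * ‖y‖) -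
      inner ℝ (p • x + q • y) y * (‖x‖ * ‖p • x + q • y‖) =
        ‖p • x + q • y‖ * (‖x‖ * ‖y‖ - inner ℝ x y) * (p * ‖x‖ - q * ‖y‖) := by
    rw [inner_add_right, inner_add_left, real_inner_smul_right, real_inner_smul_right,
      real_inner_smul_left, real_inner_smul_left, real_inner_self_eq_norm_sq,
      real_inner_self_eq_norm_sq]
    ring
  rw [← Real.injOn_cos.eq_iff
      ⟨InnerProductGeometry.angle_nonneg _ _, InnerProductGeometry.angle_le_pi _ _⟩
      ⟨InnerProductGeometry.angle_nonneg _ _, InnerProductGeometry.angle_le_pi _ _⟩,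
    InnerProductGeometry.cos_angle, InnerProductGeometry.cos_angle,
    div_eq_div_iff (mul_ne_zero hx hd') (mul_ne_zero hd' hy), ← sub_eq_zero, hfactor,
    mul_eq_zero_iff_left (mul_ne_zero hd' (sub_pos.2 hxy).ne'), sub_eq_zero]

lemma angle_lineMap_eq_iff {P₁ A P₂ : P} (h : ¬ Collinear ℝ {P₁, A, P₂}) (t : ℝ) :
    EuclideanGeometry.angle P₁ A (AffineMap.lineMap P₁ P₂ t) =
        EuclideanGeometry.angle (AffineMap.lineMap P₁ P₂ t) A P₂ ↔
      t = dist A P₁ / (dist A P₁ + dist A P₂) := by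
  obtain ⟨h₁, h₂, hangle, -⟩ : P₁ ≠ A ∧ P₂ ≠ A ∧ EuclideanGeometry.angle P₁ A P₂ ≠ 0 ∧
      EuclideanGeometry.angle P₁ A P₂ ≠ Real.pi := by
    simpa only [EuclideanGeometry.collinear_iff_eq_or_eq_or_angle_eq_zero_or_angle_eq_pi,
      not_or] using h
  have hinner : inner ℝ (P₁ -ᵥ A) (P₂ -ᵥ A) < ‖P₁ -ᵥ A‖ * ‖P₂ -ᵥ A‖ :=
    (real_inner_le_norm _ _).lt_of_ne fun heq => hangle <|
      (InnerProductGeometry.inner_eq_mul_norm_iff_angle_eq_zero (vsub_ne_zero.2 h₁)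
        (vsub_ne_zero.2 h₂)).1 heq
  have hfoot : AffineMap.lineMap P₁ P₂ t -ᵥ A = (1 - t) • (P₁ -ᵥ A) + t • (P₂ -ᵥ A) := by
    rw [AffineMap.lineMap_vsub, AffineMap.lineMap_apply_module]
  have hfoot_ne : AffineMap.lineMap P₁ P₂ t ≠ A := by
    rintro rfl
    refine h ?_
    rw [insert_comm]
    exact collinear_insert_of_mem_affineSpan_pair (AffineMap.lineMap_mem_affineSpan_pair ..)
  have hsum : 0 < dist A P₁ + dist A P₂ := add_pos (dist_pos.2 h₁.symm) (dist_pos.2 h₂.symm)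
  rw [EuclideanGeometry.angle, EuclideanGeometry.angle, hfoot,
    angle_smul_add_smul_eq_iff hinner (hfoot ▸ vsub_ne_zero.2 hfoot_ne), ← dist_eq_norm_vsub,
    ← dist_eq_norm_vsub, dist_comm P₁, dist_comm P₂, eq_div_iff hsum.ne']
  constructor <;> intro h <;> linarith

/-- The length of the side of `T` opposite to vertex `i`. -/
def sideLength (T : Affine.Triangle ℝ P) (i : Fin 3) : ℝ :=
  dist (T.points (i + 1)) (T.points (i + 2))

lemma dist_points_add_one (T : Affine.Triangle ℝ P) (i : Fin 3) :
    dist (T.points i) (T.points (i + 1)) = sideLength T (i + 2) := by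
  fin_cases i <;> rfl

lemma dist_points_add_two (T : Affine.Triangle ℝ P) (i : Fin 3) :
    dist (T.points i) (T.points (i + 2)) = sideLength T (i + 1) := by
  fin_cases i <;> exact dist_comm _ _

lemma not_collinear_points (T : Affine.Triangle ℝ P) (i : Fin 3) :
    ¬ Collinear ℝ {T.points (i + 1), T.points i, T.points (i + 2)} := fun h => by
  refine affineIndependent_iff_not_collinear.1 T.independent (h.subset ?_)
  rintro _ ⟨j, rfl⟩
  have hcases : ∀ i j : Fin 3, j = i + 1 ∨ j = i ∨ j = i + 2 := by decide
  obtain rfl | rfl | rfl := hcases i j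
  all_goals simp only [mem_insert_iff, mem_singleton_iff, true_or, or_true]

lemma sideLength_pos (T : Affine.Triangle ℝ P) (i : Fin 3) : 0 < sideLength T i :=
  dist_pos.2 fun h => absurd (T.independent.injective h) (by simp)

lemma sideLength_lt_add (T : Affine.Triangle ℝ P) (i : Fin 3) :
    sideLength T i < sideLength T (i + 1) + sideLength T (i + 2) := by
  rw [← dist_points_add_one, ← dist_points_add_two, add_comm, dist_comm]
  refine (dist_triangle ..).lt_of_ne fun h => not_collinear_points T i ?_
  exact (dist_add_dist_eq_iff.1 h.symm).collinear

lemma congruent_of_sideLength_eq {T₁ T₂ : Affine.Triangle ℝ P}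
    (h : sideLength T₁ = sideLength T₂) : Congruent T₁.points T₂.points := by
  refine congruent_iff_pairwise_dist_eq.2 fun i j hij => ?_
  obtain rfl | rfl : j = i + 1 ∨ j = i + 2 := by decide +revert
  · rw [dist_points_add_one, dist_points_add_one, h]
  · rw [dist_points_add_two, dist_points_add_two, h]

lemma sideLength_comp_of_congruent {T₁ T₂ : Affine.Triangle ℝ P} {σ : Equiv.Perm (Fin 3)}
    (h : Congruent (T₁.points ∘ σ) T₂.points) : sideLength T₁ ∘ σ = sideLength T₂ := by
  have hperm : ∀ σ : Equiv.Perm (Fin 3), ∀ i, σ (i + 1) = σ i + 1 ∧ σ (i + 2) = σ i + 2 ∨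
    σ (i + 1) = σ i + 2 ∧ σ (i + 2) = σ i + 1 := by decide
  funext i
  refine Eq.trans ?_ (h.dist_eq (i + 1) (i + 2))
  rcases hperm σ i with ⟨h₁, h₂⟩ | ⟨h₁, h₂⟩ <;>
    simp only [Function.comp_apply, sideLength, h₁, h₂, dist_comm]

/-- The length of the internal bisector to the side `a` of a triangle with sides `a`, `b`, `c`. -/
noncomputable def bisectorOfSides (a b c : ℝ) : ℝ := √(b * c * (1 - (a / (b + c)) ^ 2))

/-- The height on the side `a` of a triangle with sides `a`, `b`, `c`. -/
noncomputable def heightOfSides (a b c : ℝ) : ℝ :=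
  √((a + b + c) * (-a + b + c) * (a - b + c) * (a + b - c)) / (2 * a)

/-- The length of the median to the side `a` of a triangle with sides `a`, `b`, `c`. -/
noncomputable def medianOfSides (a b c : ℝ) : ℝ := √(2 * b ^ 2 + 2 * c ^ 2 - a ^ 2) / 2

lemma height_eq_heightOfSides (T : Affine.Triangle ℝ P) (i : Fin 3) :
    T.height i = heightOfSides (sideLength T i) (sideLength T (i + 1)) (sideLength T (i + 2)) := by
  have hmem := T.altitudeFoot_mem_affineSpan_image_compl i
  have hcompl : ({i}ᶜ : Set (Fin 3)) = {i + 1, i + 2} := by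
    ext j; fin_cases i <;> fin_cases j <;> simp
  rw [hcompl, image_pair] at hmem
  obtain ⟨τ, hτ⟩ := mem_affineSpan_pair_iff_exists_lineMap_eq.1 hmem
  have hpythagoras : ∀ j, i ≠ j → dist (T.points i) (T.points j) ^ 2 =
      T.height i ^ 2 + dist (T.points j) (T.altitudeFoot i) ^ 2 := fun j hij => by
    rw [Affine.Simplex.height, dist_comm (T.points j)]
    exact dist_sq_of_inner_eq_zero ((real_inner_comm ..).trans
      (T.inner_vsub_altitudeFoot_vsub_altitudeFoot_eq_zero hij))
  have h₁ := hpythagoras (i + 1) (by simp)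
  have h₂ := hpythagoras (i + 2) (by simp)
  rw [← hτ, dist_left_lineMap, dist_points_add_one, mul_pow, Real.norm_eq_abs, sq_abs] at h₁
  rw [← hτ, dist_comm (T.points (i + 2)), dist_lineMap_right, dist_points_add_two, mul_pow,
    Real.norm_eq_abs, sq_abs] at h₂
  have ha := sideLength_pos T i
  change _ = _ + _ * sideLength T i ^ 2 at h₁ h₂
  have heron : (2 * sideLength T i * T.height i) ^ 2 =
      (sideLength T i + sideLength T (i + 1) + sideLength T (i + 2)) *
        (-sideLength T i + sideLength T (i + 1) + sideLength T (i + 2)) *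
        (sideLength T i - sideLength T (i + 1) + sideLength T (i + 2)) *
        (sideLength T i + sideLength T (i + 1) - sideLength T (i + 2)) := by
    calc
      _ = 4 * sideLength T i ^ 2 * sideLength T (i + 2) ^ 2 -
          (sideLength T i ^ 2 + sideLength T (i + 2) ^ 2 - sideLength T (i + 1) ^ 2) ^ 2 := by
        rw [h₁, h₂]
        ring
      _ = _ := by ring
  rw [heightOfSides, ← heron, Real.sqrt_sq (by have := T.height_pos i; positivity)]
  field_simp

lemma medianLength_eq_medianOfSides (T : PlaneTriangle) (i : Fin 3) :
    medianLength T i =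
      medianOfSides (sideLength T i) (sideLength T (i + 1)) (sideLength T (i + 2)) := by
  have happ := EuclideanGeometry.dist_sq_add_dist_sq_eq_two_mul_dist_midpoint_sq_add_half_dist_sq
    (T.points i) (T.points (i + 1)) (T.points (i + 2))
  rw [dist_points_add_one, dist_points_add_two] at happ
  change _ = 2 * (medianLength T i ^ 2 + (sideLength T i / 2) ^ 2) at happ
  have hsq : 2 * sideLength T (i + 1) ^ 2 + 2 * sideLength T (i + 2) ^ 2 - sideLength T i ^ 2 =
      (2 * medianLength T i) ^ 2 := by
    linear_combination 2 * happ
  have hnonneg : 0 ≤ medianLength T i := dist_nonneg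
  rw [medianOfSides, hsq, Real.sqrt_sq (by positivity)]
  ring

lemma hasBisectorLength_iff (T : PlaneTriangle) (i : Fin 3) (l : ℝ) :
    HasBisectorLength T i l ↔
      bisectorOfSides (sideLength T i) (sideLength T (i + 1)) (sideLength T (i + 2)) = l := by
  have hfoot : ∀ t : ℝ, EuclideanGeometry.angle (T.points (i + 1)) (T.points i)
        (AffineMap.lineMap (T.points (i + 1)) (T.points (i + 2)) t) =
      EuclideanGeometry.angle (AffineMap.lineMap (T.points (i + 1)) (T.points (i + 2)) t)
        (T.points i) (T.points (i + 2)) ↔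
      t = sideLength T (i + 2) / (sideLength T (i + 2) + sideLength T (i + 1)) := fun t => by
    rw [angle_lineMap_eq_iff (not_collinear_points T i), dist_points_add_one, dist_points_add_two]
  have hb := sideLength_pos T (i + 1)
  have hc := sideLength_pos T (i + 2)
  set t₀ := sideLength T (i + 2) / (sideLength T (i + 2) + sideLength T (i + 1)) with ht₀
  have hlength : dist (T.points i) (AffineMap.lineMap (T.points (i + 1)) (T.points (i + 2)) t₀) =
      bisectorOfSides (sideLength T i) (sideLength T (i + 1)) (sideLength T (i + 2)) := by
    have hstewart := dist_lineMap_sq (T.points i) (T.points (i + 1)) (T.points (i + 2)) t₀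
    rw [dist_points_add_one, dist_points_add_two] at hstewart
    change _ = _ - _ * sideLength T i ^ 2 at hstewart
    rw [bisectorOfSides, eq_comm, ← Real.sqrt_sq dist_nonneg, hstewart, ht₀]
    congr 1
    field_simp
    ring
  rw [← hlength]
  constructor
  · rintro ⟨D, ⟨hbtw, hangle⟩, rfl⟩
    obtain ⟨⟨t, -, rfl⟩, -⟩ := sbtw_iff_mem_image_Ioo_and_ne.1 hbtw
    rw [(hfoot t).1 hangle]
  · rintro rfl
    have hmem : t₀ ∈ Ioo 0 1 := ⟨by positivity, (div_lt_one (by positivity)).2 (by linarith)⟩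
    exact ⟨_, ⟨sbtw_iff_mem_image_Ioo_and_ne.2 ⟨⟨t₀, hmem, rfl⟩, dist_pos.1 (sideLength_pos T i)⟩,
      (hfoot t₀).2 rfl⟩, rfl⟩

lemma sideLength_eq_iff {T : Affine.Triangle ℝ P} {a b c : ℝ} :
    sideLength T = ![a, b, c] ↔ sideLength T 0 = a ∧ sideLength T 1 = b ∧ sideLength T 2 = c := by
  simp [funext_iff, Fin.forall_fin_succ]

lemma exists_triangle_sideLength_eq {a b c : ℝ} (ha : a < b + c) (hb : b < a + c)
    (hc : c < a + b) : ∃ T : PlaneTriangle, sideLength T = ![a, b, c] := by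
  have ha₀ : 0 < a := by linarith
  have hb₀ : 0 < b := by linarith
  have hc₀ : 0 < c := by linarith
  obtain ⟨x, hx⟩ : ∃ x, 2 * c * x = b ^ 2 + c ^ 2 - a ^ 2 :=
    ⟨(b ^ 2 + c ^ 2 - a ^ 2) / (2 * c), by field_simp⟩
  have hxb : x ^ 2 ≤ b ^ 2 := by
    refine sq_le_sq' (le_of_mul_le_mul_left (?_ : 2 * c * -b ≤ 2 * c * x) (by positivity))
      (le_of_mul_le_mul_left (?_ : 2 * c * x ≤ 2 * c * b) (by positivity)) <;>
    rw [hx] <;> nlinarith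
  let A : EuclideanSpace ℝ (Fin 2) := !₂[0, 0]
  let B : EuclideanSpace ℝ (Fin 2) := !₂[c, 0]
  let C : EuclideanSpace ℝ (Fin 2) := !₂[x, √(b ^ 2 - x ^ 2)]
  have hAB : dist A B = c := by
    simp [A, B, EuclideanSpace.dist_eq, Real.dist_eq, Real.sqrt_sq hc₀.le]
  have hCA : dist C A = b := by
    simp [A, C, EuclideanSpace.dist_eq, Real.dist_eq, Real.sq_sqrt (sub_nonneg.2 hxb),
      Real.sqrt_sq hb₀.le]
  have hBC : dist B C = a := by
    have : (c - x) ^ 2 + (b ^ 2 - x ^ 2) = a ^ 2 := by linear_combination -hx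
    simp [B, C, EuclideanSpace.dist_eq, Real.dist_eq, Real.sq_sqrt (sub_nonneg.2 hxb), this,
      Real.sqrt_sq ha₀.le]
  have hindep : AffineIndependent ℝ ![A, B, C] := by
    refine affineIndependent_iff_not_collinear_set.2 fun h => ?_
    rcases h.wbtw_or_wbtw_or_wbtw with h | h | h <;>
      linarith [h.dist_add_dist, dist_comm A B, dist_comm B C, dist_comm C A]
  exact ⟨⟨![A, B, C], hindep⟩, sideLength_eq_iff.2 ⟨hBC, hCA, hAB⟩⟩

end Triangle

/-! ### The shape of a triangle -/

section Shape

variable {w c s t V : ℝ}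

/-- The square of the ratio of the bisector from `A` to the side `c` in a triangle with
semiperimeter `p`, where `w = (p - a) / c` and `s = (p - c) / p`. Exchanging `A` and `B` replaces
`w` by `1 - w`. -/
noncomputable def bisectorRatioSq (w s : ℝ) : ℝ := 4 * w * (w + s * (1 - w)) / (1 + (1 - s) * w) ^ 2

/-- The side `a` of the triangle with side `c` and semiperimeter `p`, where `w = (p - a) / c` and
`s = (p - c) / p`; the side `b` is `shapeSide (1 - w) c s`. For `s = 1` it has no meaning. -/
noncomputable def shapeSide (w c s : ℝ) : ℝ := c * (1 / (1 - s) - w)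

lemma bisectorRatioSq_pos (hw : 0 < w) (hw₁ : w ≤ 1) (hs : s ∈ Icc (0 : ℝ) 1) :
    0 < bisectorRatioSq w s := by
  have hnum : 0 < w + s * (1 - w) := by nlinarith [mul_nonneg hs.1 (sub_nonneg.2 hw₁)]
  have hden : 0 < 1 + (1 - s) * w := by nlinarith [mul_nonneg (sub_nonneg.2 hs.2) hw.le]
  unfold bisectorRatioSq
  positivity

lemma strictMonoOn_bisectorRatioSq_left (hs : s ∈ Icc (0 : ℝ) 1) :
    StrictMonoOn (bisectorRatioSq · s) (Icc 0 1) := by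
  intro w hw w' hw' hlt
  have hs₁ : 0 ≤ 1 - s := sub_nonneg.2 hs.2
  have hden : ∀ u ∈ Icc (0 : ℝ) 1, 0 < 1 + (1 - s) * u := fun u hu => by
    linarith [mul_nonneg hs₁ hu.1]
  have hfirst : w / (1 + (1 - s) * w) < w' / (1 + (1 - s) * w') := by
    rw [div_lt_div_iff₀ (hden w hw) (hden w' hw')]
    linarith
  have hsecond : (w + s * (1 - w)) / (1 + (1 - s) * w) ≤
      (w' + s * (1 - w')) / (1 + (1 - s) * w') := by
    rw [div_le_div_iff₀ (hden w hw) (hden w' hw')]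
    nlinarith [mul_nonneg (sub_nonneg.2 hlt.le) (sq_nonneg (1 - s))]
  have hsecond_pos : 0 < (w' + s * (1 - w')) / (1 + (1 - s) * w') :=
    div_pos (by nlinarith [hw.1, mul_nonneg hs.1 (sub_nonneg.2 hw'.2)]) (hden w' hw')
  have hfactor (u : ℝ) : bisectorRatioSq u s =
      4 * (u / (1 + (1 - s) * u) * ((u + s * (1 - u)) / (1 + (1 - s) * u))) := by
    rw [bisectorRatioSq, div_mul_div_comm, ← sq, mul_assoc, mul_div_assoc]
  simp only [hfactor]
  refine mul_lt_mul_of_pos_left ?_ four_pos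
  exact (mul_le_mul_of_nonneg_left hsecond (div_nonneg hw.1 (hden w hw).le)).trans_lt
    (mul_lt_mul_of_pos_right hfirst hsecond_pos)

lemma strictMonoOn_bisectorRatioSq_right (hw : 0 < w) (hw₁ : w < 1) :
    StrictMonoOn (bisectorRatioSq w) (Icc 0 1) := by
  intro s hs t ht hst
  have : 0 < 1 - w := sub_pos.2 hw₁
  have := hs.1
  have ht₀ := ht.1
  have ht₁ : 0 ≤ 1 - t := sub_nonneg.2 ht.2
  unfold bisectorRatioSq
  refine div_lt_div₀ ?_ ?_ (by positivity) (by positivity) <;> gcongr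

lemma continuousOn_bisectorRatioSq :
    ContinuousOn (fun q : ℝ × ℝ => bisectorRatioSq q.1 q.2) (Icc 0 1 ×ˢ Icc 0 1) := by
  unfold bisectorRatioSq
  refine ContinuousOn.div (by fun_prop) (by fun_prop) fun q hq => ?_
  have : 0 < 1 + (1 - q.2) * q.1 := by
    linarith [mul_nonneg (sub_nonneg.2 hq.2.2) hq.1.1]
  positivity

set_option maxRecDepth 4000 in
lemma homogeneous_bisectorRatioSq_lt {e q i : ℝ} (hV : 0 < V) (hs : 0 < s) (he : 0 < e)
    (hq : 0 ≤ q) (hi : i = s + e + q) :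
    s ^ 2 * (V * i ^ 2 + (s + e) ^ 2) *
        ((2 * V * i + s - V * s) * (V * i ^ 2 + 2 * (s + e) * i - (s + e) ^ 2)) ^ 2 <
      (s + e) ^ 2 * (V * i ^ 2 + s ^ 2) *
        ((2 * V * i + (s + e) - V * (s + e)) * (V * i ^ 2 + 2 * s * i - s ^ 2)) ^ 2 := by
  subst hi
  rw [← sub_pos]
  -- After homogenizing with `i = 1`, all coefficients in `V`, `s`, `e`, `q` are nonnegative.
  ring_nf
  positivity

lemma bisectorRatioSq_mul_lt (hV : 0 < V) (hs : 0 < s) (hst : s < t) (ht : t ≤ 1) :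
    bisectorRatioSq (V / (V + t)) t * bisectorRatioSq (1 - V / (V + s)) s <
      bisectorRatioSq (V / (V + s)) s * bisectorRatioSq (1 - V / (V + t)) t := by
  have hden : ∀ {u : ℝ}, 0 < u → u ≤ 1 → 0 < 2 * V + u - V * u ∧ 0 < V + 2 * u - u ^ 2 :=
    fun hu hu₁ => ⟨by nlinarith, by nlinarith⟩
  have hleft : ∀ {u : ℝ}, 0 < u →
      bisectorRatioSq (V / (V + u)) u = 4 * V * (V + u ^ 2) / (2 * V + u - V * u) ^ 2 := by
    intro u hu
    have h₁ : V / (V + u) + u * (1 - V / (V + u)) = (V + u ^ 2) / (V + u) := by field_simp; ring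
    have h₂ : 1 + (1 - u) * (V / (V + u)) = (2 * V + u - V * u) / (V + u) := by field_simp; ring
    rw [bisectorRatioSq, h₁, h₂]
    field_simp
  have hright : ∀ {u : ℝ}, 0 < u →
      bisectorRatioSq (1 - V / (V + u)) u = 4 * (1 + V) * u ^ 2 / (V + 2 * u - u ^ 2) ^ 2 := by
    intro u hu
    have h₀ : 1 - V / (V + u) = u / (V + u) := by field_simp; ring
    have h₁ : u / (V + u) + u * (1 - u / (V + u)) = u * (1 + V) / (V + u) := by field_simp; ring
    have h₂ : 1 + (1 - u) * (u / (V + u)) = (V + 2 * u - u ^ 2) / (V + u) := by field_simp; ring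
    rw [h₀, bisectorRatioSq, h₁, h₂]
    field_simp
  have ht₀ := hs.trans hst
  have hs₁ := hst.le.trans ht
  obtain ⟨hds, hds'⟩ := hden hs hs₁
  obtain ⟨hdt, hdt'⟩ := hden ht₀ ht
  have key := homogeneous_bisectorRatioSq_lt (i := 1) hV hs (sub_pos.2 hst) (sub_nonneg.2 ht)
    (by ring)
  rw [add_sub_cancel] at key
  rw [hleft ht₀, hleft hs, hright hs, hright ht₀, div_mul_div_comm,
    div_mul_div_comm, div_lt_div_iff₀ (by positivity) (by positivity)]
  convert mul_lt_mul_of_pos_left key (by positivity : 0 < 16 * V * (1 + V)) using 1 <;> ring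

lemma shapeSide_pos (hw : w < 1) (hc : 0 < c) (hs : s ∈ Ico (0 : ℝ) 1) : 0 < shapeSide w c s := by
  have : 1 ≤ 1 / (1 - s) := (one_le_div (sub_pos.2 hs.2)).2 (by linarith [hs.1])
  exact mul_pos hc (by linarith)

lemma bisectorOfSides_comm (a b c : ℝ) : bisectorOfSides a b c = bisectorOfSides a c b := by
  rw [bisectorOfSides, bisectorOfSides, mul_comm b, add_comm b]

lemma bisectorOfSides_shapeSide (hw : 0 < w) (hc : 0 < c) (hs : s ∈ Ico (0 : ℝ) 1) :
    bisectorOfSides (shapeSide w c s) (shapeSide (1 - w) c s) c =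
      √(c ^ 2 * bisectorRatioSq w s) := by
  have hs₁ : 0 < 1 - s := sub_pos.2 hs.2
  have hsum : shapeSide (1 - w) c s + c = c * (1 + (1 - s) * w) / (1 - s) := by
    unfold shapeSide; field_simp; ring
  rw [bisectorOfSides, hsum, bisectorRatioSq]
  unfold shapeSide
  congr 1
  field_simp
  ring

end Shape

/-! ### The family of triangles with two given bisectors -/

section Family

variable {la lb s : ℝ}

/-- Vanishes exactly when the bisectors from `A` and `B` of the shape `(w, s)` have the ratio
`la : lb`. -/
noncomputable def bisectorDefect (la lb w s : ℝ) : ℝ :=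
  lb ^ 2 * bisectorRatioSq w s - la ^ 2 * bisectorRatioSq (1 - w) s

lemma strictMonoOn_bisectorDefect (hlb : 0 < lb) (hs : s ∈ Icc (0 : ℝ) 1) :
    StrictMonoOn (bisectorDefect la lb · s) (Icc 0 1) := by
  intro w hw w' hw' hlt
  have h₁ := strictMonoOn_bisectorRatioSq_left hs hw hw' hlt
  have h₂ := (strictMonoOn_bisectorRatioSq_left hs).monotoneOn
    (Icc.mem_iff_one_sub_mem.1 hw') (Icc.mem_iff_one_sub_mem.1 hw) (sub_le_sub_left hlt.le 1)
  simp only [bisectorDefect]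
  linarith [mul_lt_mul_of_pos_left h₁ (pow_pos hlb 2),
    mul_le_mul_of_nonneg_left h₂ (sq_nonneg la)]

lemma continuousOn_bisectorDefect :
    ContinuousOn (fun q : ℝ × ℝ => bisectorDefect la lb q.1 q.2) (Icc 0 1 ×ˢ Icc 0 1) := by
  have hflip : ContinuousOn (fun q : ℝ × ℝ => bisectorRatioSq (1 - q.1) q.2)
      (Icc 0 1 ×ˢ Icc 0 1) :=
    continuousOn_bisectorRatioSq.comp (f := fun q : ℝ × ℝ => (1 - q.1, q.2))
      (by fun_prop) fun q hq => ⟨Icc.mem_iff_one_sub_mem.1 hq.1, hq.2⟩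
  exact (continuousOn_bisectorRatioSq.const_smul (lb ^ 2)).sub (hflip.const_smul (la ^ 2))

lemma exists_bisectorDefect_eq_zero (hla : 0 < la) (hlb : 0 < lb) (hs : s ∈ Icc (0 : ℝ) 1) :
    ∃ w ∈ Ioo (0 : ℝ) 1, bisectorDefect la lb w s = 0 := by
  have hzero : bisectorRatioSq 0 s = 0 := by simp [bisectorRatioSq]
  have hone := bisectorRatioSq_pos one_pos le_rfl hs
  have hneg : bisectorDefect la lb 0 s < 0 := by
    rw [bisectorDefect, hzero, sub_zero, mul_zero, zero_sub]
    exact neg_neg_of_pos (by positivity)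
  have hpos : 0 < bisectorDefect la lb 1 s := by
    rw [bisectorDefect, sub_self, hzero, mul_zero, sub_zero]
    positivity
  have hcont : ContinuousOn (bisectorDefect la lb · s) (Icc 0 1) :=
    continuousOn_bisectorDefect.comp (f := fun w : ℝ => (w, s)) (by fun_prop)
      fun _ hw => ⟨hw, hs⟩
  exact intermediate_value_Ioo zero_le_one hcont ⟨hneg, hpos⟩

/-- For every `s` in `[0, 1]`, the shape `(w s, s)` scaled to the side `c s` has bisectors `la` and
`lb` from `A` and `B`. The values `s = 0` and `s = 1` are the two degenerate limits, where `C` lies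
on the segment `AB` and at infinity, respectively. -/
structure IsBisectorFamily (la lb : ℝ) (w c : ℝ → ℝ) : Prop where
  left_pos : 0 < la
  right_pos : 0 < lb
  w_mem : ∀ s ∈ Icc (0 : ℝ) 1, w s ∈ Ioo (0 : ℝ) 1
  c_pos : ∀ s ∈ Icc (0 : ℝ) 1, 0 < c s
  left_eq : ∀ s ∈ Icc (0 : ℝ) 1, c s ^ 2 * bisectorRatioSq (w s) s = la ^ 2
  right_eq : ∀ s ∈ Icc (0 : ℝ) 1, c s ^ 2 * bisectorRatioSq (1 - w s) s = lb ^ 2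

theorem exists_isBisectorFamily (hla : 0 < la) (hlb : 0 < lb) :
    ∃ w c : ℝ → ℝ, IsBisectorFamily la lb w c := by
  choose! w hw hdefect using
    fun s (hs : s ∈ Icc (0 : ℝ) 1) => exists_bisectorDefect_eq_zero hla hlb hs
  have hratio : ∀ s ∈ Icc (0 : ℝ) 1, 0 < bisectorRatioSq (w s) s := fun s hs =>
    bisectorRatioSq_pos (hw s hs).1 (hw s hs).2.le hs
  have hscale : ∀ s ∈ Icc (0 : ℝ) 1,
      (la / √(bisectorRatioSq (w s) s)) ^ 2 = la ^ 2 / bisectorRatioSq (w s) s := fun s hs => by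
    rw [div_pow, Real.sq_sqrt (hratio s hs).le]
  refine ⟨w, fun s => la / √(bisectorRatioSq (w s) s), hla, hlb, hw,
    fun s hs => div_pos hla (Real.sqrt_pos.2 (hratio s hs)), fun s hs => ?_, fun s hs => ?_⟩
  · rw [hscale s hs, div_mul_cancel₀ _ (hratio s hs).ne']
  · rw [hscale s hs, div_mul_eq_mul_div, div_eq_iff (hratio s hs).ne',
      ← sub_eq_zero.1 (hdefect s hs)]

end Family

namespace IsBisectorFamily

variable {la lb w₀ c₀ s t : ℝ} {w c : ℝ → ℝ} (h : IsBisectorFamily la lb w c)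
include h

lemma swap : IsBisectorFamily lb la (fun s => 1 - w s) c where
  left_pos := h.right_pos
  right_pos := h.left_pos
  w_mem s hs := Ioo.mem_iff_one_sub_mem.1 (h.w_mem s hs)
  c_pos := h.c_pos
  left_eq := h.right_eq
  right_eq s hs := by simpa only [sub_sub_cancel] using h.left_eq s hs

lemma bisectorRatioSq_pos (hs : s ∈ Icc (0 : ℝ) 1) : 0 < bisectorRatioSq (w s) s :=
  TwoBisectors.bisectorRatioSq_pos (h.w_mem s hs).1 (h.w_mem s hs).2.le hs

lemma bisectorDefect_eq_zero (hs : s ∈ Icc (0 : ℝ) 1) : bisectorDefect la lb (w s) s = 0 := by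
  rw [bisectorDefect, ← h.left_eq s hs, ← h.right_eq s hs]
  ring

lemma lt_w_of_bisectorDefect_neg (hs : s ∈ Icc (0 : ℝ) 1) (hw₀ : w₀ ∈ Icc (0 : ℝ) 1)
    (hneg : bisectorDefect la lb w₀ s < 0) : w₀ < w s := by
  rw [← h.bisectorDefect_eq_zero hs] at hneg
  exact (strictMonoOn_bisectorDefect h.right_pos hs).lt_iff_lt hw₀
    (Ioo_subset_Icc_self (h.w_mem s hs)) |>.1 hneg

lemma eq_of_bisectorRatioSq_eq (hs : s ∈ Icc (0 : ℝ) 1) (hw₀ : w₀ ∈ Ioo (0 : ℝ) 1) (hc₀ : 0 < c₀)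
    (hleft : c₀ ^ 2 * bisectorRatioSq w₀ s = la ^ 2)
    (hright : c₀ ^ 2 * bisectorRatioSq (1 - w₀) s = lb ^ 2) : w₀ = w s ∧ c₀ = c s := by
  have hdefect : bisectorDefect la lb w₀ s = bisectorDefect la lb (w s) s := by
    rw [h.bisectorDefect_eq_zero hs, bisectorDefect, ← hleft, ← hright]
    ring
  obtain rfl : w₀ = w s := (strictMonoOn_bisectorDefect h.right_pos hs).injOn
    (Ioo_subset_Icc_self hw₀) (Ioo_subset_Icc_self (h.w_mem s hs)) hdefect
  have hsq : c₀ ^ 2 = c s ^ 2 :=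
    mul_right_cancel₀ (h.bisectorRatioSq_pos hs).ne' (hleft.trans (h.left_eq s hs).symm)
  exact ⟨rfl, (pow_left_inj₀ hc₀.le (h.c_pos s hs).le two_ne_zero).1 hsq⟩

lemma continuousOn_w : ContinuousOn w (Icc 0 1) :=
  continuousOn_of_strictMonoOn_implicit (J := Icc (0 : ℝ) 1) (G := bisectorDefect la lb)
    (fun y hy => continuousOn_bisectorDefect.comp (f := fun s : ℝ => (y, s)) (by fun_prop)
      fun _ hs => ⟨hy, hs⟩)
    (fun _ hs => strictMonoOn_bisectorDefect h.right_pos hs)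
    (fun s hs => Ioo_subset_Icc_self (h.w_mem s hs)) fun _ hs => h.bisectorDefect_eq_zero hs

lemma continuousOn_c : ContinuousOn c (Icc 0 1) := by
  have hratio : ContinuousOn (fun s => bisectorRatioSq (w s) s) (Icc 0 1) :=
    continuousOn_bisectorRatioSq.comp (f := fun s => (w s, s))
      (h.continuousOn_w.prodMk continuousOn_id) fun s hs => ⟨Ioo_subset_Icc_self (h.w_mem s hs), hs⟩
  refine ((continuousOn_const.div hratio fun s hs => (h.bisectorRatioSq_pos hs).ne').sqrt).congr
    (f := fun s => √(la ^ 2 / bisectorRatioSq (w s) s)) fun s hs => ?_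
  dsimp only
  rw [← h.left_eq s hs, mul_div_cancel_right₀ _ (h.bisectorRatioSq_pos hs).ne',
    Real.sqrt_sq (h.c_pos s hs).le]

/-- `s * w s / (1 - w s)` is `tan² (B / 2)`. -/
lemma strictMonoOn_mul_div : StrictMonoOn (fun s => s * (w s / (1 - w s))) (Icc 0 1) := by
  intro s hs t ht hst
  have hodds : ∀ u ∈ Icc (0 : ℝ) 1, 0 < w u / (1 - w u) := fun u hu =>
    div_pos (h.w_mem u hu).1 (sub_pos.2 (h.w_mem u hu).2)
  rcases hs.1.eq_or_lt with rfl | hs₀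
  · simpa only [zero_mul] using mul_pos hst (hodds t ht)
  set V := s * (w s / (1 - w s)) with hVdef
  have hV : 0 < V := mul_pos hs₀ (hodds s hs)
  have ht₀ : 0 < t := hs₀.trans hst
  have hws : V / (V + s) = w s := by
    have := sub_pos.2 (h.w_mem s hs).2
    rw [hVdef]
    field_simp
    ring
  have hmem : V / (V + t) ∈ Ioo (0 : ℝ) 1 :=
    ⟨by positivity, (div_lt_one (by positivity)).2 (lt_add_of_pos_right V ht₀)⟩
  have hlt : V / (V + t) < w t := by
    refine h.lt_w_of_bisectorDefect_neg ht (Ioo_subset_Icc_self hmem) ?_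
    have key := bisectorRatioSq_mul_lt hV hs₀ hst ht.2
    rw [hws] at key
    rw [bisectorDefect, ← h.left_eq s hs, ← h.right_eq s hs, sub_neg]
    have := mul_lt_mul_of_pos_left key (pow_pos (h.c_pos s hs) 2)
    linarith
  rw [div_lt_iff₀ (by positivity)] at hlt
  have := sub_pos.2 (h.w_mem t ht).2
  change V < t * (w t / (1 - w t))
  rw [← mul_div_assoc, lt_div_iff₀ this]
  linarith

lemma c_lt_of_le (hs : s ∈ Icc (0 : ℝ) 1) (ht : t ∈ Icc (0 : ℝ) 1) (hst : s < t)
    (hw : w s ≤ w t) : c t < c s := by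
  have hlt : bisectorRatioSq (w s) s < bisectorRatioSq (w t) t :=
    (strictMonoOn_bisectorRatioSq_right (h.w_mem s hs).1 (h.w_mem s hs).2 hs ht hst).trans_le
      ((strictMonoOn_bisectorRatioSq_left ht).monotoneOn (Ioo_subset_Icc_self (h.w_mem s hs))
        (Ioo_subset_Icc_self (h.w_mem t ht)) hw)
  by_contra! hle
  have := mul_lt_mul_of_pos_left hlt (pow_pos (h.c_pos s hs) 2)
  have := mul_le_mul_of_nonneg_right (pow_le_pow_left₀ (h.c_pos s hs).le hle 2)
    (h.bisectorRatioSq_pos ht).le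
  linarith [h.left_eq s hs, h.left_eq t ht]

lemma strictAntiOn_c : StrictAntiOn c (Icc 0 1) := fun s hs t ht hst =>
  (le_total (w s) (w t)).elim (h.c_lt_of_le hs ht hst) fun hw =>
    h.swap.c_lt_of_le hs ht hst (sub_le_sub_left hw 1)

lemma shapeSide_pos (hs : s ∈ Ico (0 : ℝ) 1) : 0 < shapeSide (w s) (c s) s :=
  TwoBisectors.shapeSide_pos (h.w_mem s (Ico_subset_Icc_self hs)).2
    (h.c_pos s (Ico_subset_Icc_self hs)) hs

/-- As `lb = 2 a c cos (B / 2) / (a + c)`. -/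
lemma sq_mul_inv_add_inv (hs : s ∈ Ico (0 : ℝ) 1) :
    lb ^ 2 * (1 / shapeSide (w s) (c s) s + 1 / c s) ^ 2 * (1 + s * (w s / (1 - w s))) = 4 := by
  have hs' := Ico_subset_Icc_self hs
  have hw := h.w_mem s hs'
  have hw₁ := sub_pos.2 hw.2
  have hs₁ := sub_pos.2 hs.2
  have hc := h.c_pos s hs'
  have := h.shapeSide_pos hs
  rw [← h.right_eq s hs']
  set D := 1 - (1 - s) * w s with hD
  have hD₀ : 0 < D := by nlinarith [hw.1, hw.2, hs.1]
  have : 0 < 1 + (1 - s) * (1 - w s) := by positivity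
  have hsum : 1 / shapeSide (w s) (c s) s + 1 / c s = (1 + (1 - s) * (1 - w s)) / (c s * D) := by
    have ha : shapeSide (w s) (c s) s = c s * D / (1 - s) := by
      rw [shapeSide, hD]; field_simp
    rw [ha]
    field_simp
    rw [hD]
    ring
  have hV : 1 + s * (w s / (1 - w s)) = D / (1 - w s) := by
    rw [hD]; field_simp; ring
  have hnum : 1 - w s + s * w s = D := by rw [hD]; ring
  rw [hsum, hV, bisectorRatioSq, sub_sub_cancel, hnum]
  field_simp

lemma strictMonoOn_shapeSide : StrictMonoOn (fun s => shapeSide (w s) (c s) s) (Ico 0 1) := by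
  intro s hs t ht hst
  have hs' := Ico_subset_Icc_self hs
  have ht' := Ico_subset_Icc_self ht
  have has := h.shapeSide_pos hs
  have hcs := h.c_pos s hs'
  have hct := h.c_pos t ht'
  have hV := h.strictMonoOn_mul_div hs' ht' hst
  have hVs : 0 ≤ s * (w s / (1 - w s)) :=
    mul_nonneg hs.1 (div_pos (h.w_mem s hs').1 (sub_pos.2 (h.w_mem s hs').2)).le
  have hinv : 1 / c s < 1 / c t := one_div_lt_one_div_of_lt hct (h.strictAntiOn_c hs' ht' hst)
  by_contra! hle
  have hlt : 1 / shapeSide (w s) (c s) s + 1 / c s < 1 / shapeSide (w t) (c t) t + 1 / c t :=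
    add_lt_add_of_le_of_lt (one_div_le_one_div_of_le (h.shapeSide_pos ht) hle) hinv
  have hlb := pow_pos h.right_pos 2
  refine lt_irrefl (4 : ℝ) ?_
  calc (4 : ℝ) = lb ^ 2 * (1 / shapeSide (w s) (c s) s + 1 / c s) ^ 2 *
        (1 + s * (w s / (1 - w s))) := (h.sq_mul_inv_add_inv hs).symm
    _ < lb ^ 2 * (1 / shapeSide (w t) (c t) t + 1 / c t) ^ 2 * (1 + t * (w t / (1 - w t))) := by
        gcongr
    _ = 4 := h.sq_mul_inv_add_inv ht

lemma continuousOn_shapeSide : ContinuousOn (fun s => shapeSide (w s) (c s) s) (Ico 0 1) := by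
  have hw := h.continuousOn_w.mono Ico_subset_Icc_self
  have hc := h.continuousOn_c.mono Ico_subset_Icc_self
  unfold shapeSide
  exact hc.mul ((continuousOn_const.div (by fun_prop) fun s hs => (sub_pos.2 hs.2).ne').sub hw)

lemma tendsto_shapeSide_atTop : Tendsto (fun s => shapeSide (w s) (c s) s) (𝓝[<] 1) atTop := by
  have hsub : Tendsto (fun s : ℝ => 1 - s) (𝓝[<] 1) (𝓝[>] 0) := by
    refine tendsto_nhdsWithin_iff.2 ⟨?_, ?_⟩
    · simpa only [sub_self] using
        tendsto_nhdsLT_of_continuousOn_Icc (f := fun s : ℝ => 1 - s) zero_lt_one (by fun_prop)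
    · filter_upwards [self_mem_nhdsWithin] with s hs using sub_pos.2 (mem_Iio.1 hs)
  refine (tendsto_nhdsLT_of_continuousOn_Icc zero_lt_one h.continuousOn_c).pos_mul_atTop
    (h.c_pos 1 (right_mem_Icc.2 zero_le_one)) ?_
  simp only [one_div, sub_eq_add_neg]
  exact (tendsto_inv_nhdsGT_zero.comp hsub).atTop_add
    (tendsto_nhdsLT_of_continuousOn_Icc zero_lt_one h.continuousOn_w).neg

end IsBisectorFamily

section Counting

lemma perm_fin_three_of_forall_ne {σ : Equiv.Perm (Fin 3)} (hσ : ∀ i, σ i ≠ i) :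
    σ 0 = 1 ∧ σ 1 = 2 ∧ σ 2 = 0 ∨ σ 0 = 2 ∧ σ 1 = 0 ∧ σ 2 = 1 := by
  decide +revert

/-- The sides `a`, `b`, `c` of the triangle with parameter `s` in the family `(w, c)`. -/
noncomputable def familySides (w c : ℝ → ℝ) (s : ℝ) : Fin 3 → ℝ :=
  ![shapeSide (w s) (c s) s, shapeSide (1 - w s) (c s) s, c s]

/-- On the triangles of the family `(w, c)`, the element `f` of a triangle is the function `F` of
the parameter. -/
def IsElementAlong (w c : ℝ → ℝ) (f : PlaneTriangle → ℝ) (F : ℝ → ℝ) : Prop :=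
  ∀ s ∈ Ioo (0 : ℝ) 1, ∀ T : PlaneTriangle, sideLength T = familySides w c s → f T = F s

variable {la lb w₀ c₀ s : ℝ}

lemma exists_triangle_sideLength_eq_shapeSide (hw : w₀ ∈ Ioo (0 : ℝ) 1) (hc : 0 < c₀)
    (hs : s ∈ Ioo (0 : ℝ) 1) : ∃ T : PlaneTriangle,
      sideLength T = ![shapeSide w₀ c₀ s, shapeSide (1 - w₀) c₀ s, c₀] := by
  have hinv : 1 < 1 / (1 - s) := (one_lt_div (sub_pos.2 hs.2)).2 (sub_lt_self 1 hs.1)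
  have hcw := mul_pos hc hw.1
  have hcw' := mul_pos hc (sub_pos.2 hw.2)
  have hcs := mul_pos hc (sub_pos.2 hinv)
  refine exists_triangle_sideLength_eq ?_ ?_ ?_ <;> unfold shapeSide <;> linarith

lemma exists_sideLength_eq_shapeSide (T : PlaneTriangle) : ∃ s ∈ Ioo (0 : ℝ) 1,
    ∃ w₀ ∈ Ioo (0 : ℝ) 1, ∃ c₀ > 0,
      sideLength T = ![shapeSide w₀ c₀ s, shapeSide (1 - w₀) c₀ s, c₀] := by
  have hA : sideLength T 0 < sideLength T 1 + sideLength T 2 := sideLength_lt_add T 0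
  have hB : sideLength T 1 < sideLength T 2 + sideLength T 0 := sideLength_lt_add T 1
  have hC : sideLength T 2 < sideLength T 0 + sideLength T 1 := sideLength_lt_add T 2
  have hc := sideLength_pos T 2
  generalize ha' : sideLength T 0 = a at hA hB hC
  generalize hb' : sideLength T 1 = b at hA hB hC
  generalize hc' : sideLength T 2 = c at hA hB hC hc
  have hsum : 0 < a + b + c := by linarith
  have hsub : 1 - (a + b - c) / (a + b + c) = 2 * c / (a + b + c) := by field_simp; ring
  refine ⟨(a + b - c) / (a + b + c), ⟨div_pos (by linarith) hsum, ?_⟩,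
    (b + c - a) / (2 * c), ⟨div_pos (by linarith) (by linarith), ?_⟩, c, hc, ?_⟩
  · rw [div_lt_one hsum]
    linarith
  · rw [div_lt_one (by linarith)]
    linarith
  · rw [sideLength_eq_iff, ha', hb', hc', shapeSide, shapeSide, hsub]
    refine ⟨?_, ?_, rfl⟩ <;> field_simp <;> ring

variable {T : PlaneTriangle}

lemma hasBisectorLength_zero_iff_of_sideLength_eq (hw : 0 < w₀) (hc : 0 < c₀)
    (hs : s ∈ Ico (0 : ℝ) 1)
    (hT : sideLength T = ![shapeSide w₀ c₀ s, shapeSide (1 - w₀) c₀ s, c₀]) :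
    HasBisectorLength T 0 la ↔ √(c₀ ^ 2 * bisectorRatioSq w₀ s) = la := by
  rw [← bisectorOfSides_shapeSide hw hc hs, hasBisectorLength_iff, hT]
  rfl

lemma hasBisectorLength_one_iff_of_sideLength_eq (hw : w₀ < 1) (hc : 0 < c₀)
    (hs : s ∈ Ico (0 : ℝ) 1)
    (hT : sideLength T = ![shapeSide w₀ c₀ s, shapeSide (1 - w₀) c₀ s, c₀]) :
    HasBisectorLength T 1 lb ↔ √(c₀ ^ 2 * bisectorRatioSq (1 - w₀) s) = lb := by
  rw [← bisectorOfSides_shapeSide (sub_pos.2 hw) hc hs, sub_sub_cancel, hasBisectorLength_iff, hT,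
    bisectorOfSides_comm]
  rfl

end Counting

namespace IsBisectorFamily

variable {la lb s t x : ℝ} {w c F : ℝ → ℝ} {f : PlaneTriangle → ℝ} (h : IsBisectorFamily la lb w c)
include h

lemma hasBisectorLength_iff_exists (T : PlaneTriangle) :
    HasBisectorLength T 0 la ∧ HasBisectorLength T 1 lb ↔
      ∃ s ∈ Ioo (0 : ℝ) 1, sideLength T = familySides w c s := by
  constructor
  · rintro ⟨hA, hB⟩
    obtain ⟨s, hs, w₀, hw₀, c₀, hc₀, hT⟩ := exists_sideLength_eq_shapeSide T
    rw [hasBisectorLength_zero_iff_of_sideLength_eq hw₀.1 hc₀ (Ioo_subset_Ico_self hs) hT,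
      Real.sqrt_eq_iff_mul_self_eq_of_pos h.left_pos, ← sq] at hA
    rw [hasBisectorLength_one_iff_of_sideLength_eq hw₀.2 hc₀ (Ioo_subset_Ico_self hs) hT,
      Real.sqrt_eq_iff_mul_self_eq_of_pos h.right_pos, ← sq] at hB
    obtain ⟨rfl, rfl⟩ :=
      h.eq_of_bisectorRatioSq_eq (Ioo_subset_Icc_self hs) hw₀ hc₀ hA.symm hB.symm
    exact ⟨s, hs, hT⟩
  · rintro ⟨s, hs, hT⟩
    have hs' := Ioo_subset_Icc_self hs
    have hw := h.w_mem s hs'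
    have hc := h.c_pos s hs'
    rw [hasBisectorLength_zero_iff_of_sideLength_eq hw.1 hc (Ioo_subset_Ico_self hs) hT,
      hasBisectorLength_one_iff_of_sideLength_eq hw.2 hc (Ioo_subset_Ico_self hs) hT,
      h.left_eq s hs', h.right_eq s hs']
    exact ⟨Real.sqrt_sq h.left_pos.le, Real.sqrt_sq h.right_pos.le⟩

lemma exists_triangle_sideLength_eq (hs : s ∈ Ioo (0 : ℝ) 1) :
    ∃ T : PlaneTriangle, sideLength T = familySides w c s :=
  exists_triangle_sideLength_eq_shapeSide (h.w_mem s (Ioo_subset_Icc_self hs))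
    (h.c_pos s (Ioo_subset_Icc_self hs)) hs

lemma mem_trianglesWith_iff (hF : IsElementAlong w c f F) {T : PlaneTriangle} :
    T ∈ trianglesWith la lb f x ↔
      ∃ s ∈ Ioo (0 : ℝ) 1 ∩ F ⁻¹' {x}, sideLength T = familySides w c s := by
  constructor
  · rintro ⟨hA, hB, rfl⟩
    obtain ⟨s, hs, hT⟩ := (h.hasBisectorLength_iff_exists T).1 ⟨hA, hB⟩
    exact ⟨s, ⟨hs, (hF s hs T hT).symm⟩, hT⟩
  · rintro ⟨s, ⟨hs, rfl⟩, hT⟩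
    obtain ⟨hA, hB⟩ := (h.hasBisectorLength_iff_exists T).2 ⟨s, hs, hT⟩
    exact ⟨hA, hB, hF s hs T hT⟩

lemma w_eq_half_of_eq (hl : la = lb) (hs : s ∈ Icc (0 : ℝ) 1) : w s = 1 - w s := by
  subst hl
  exact (h.swap.eq_of_bisectorRatioSq_eq hs (h.w_mem s hs) (h.c_pos s hs) (h.left_eq s hs)
    (h.right_eq s hs)).1

lemma sideLength_zero_eq_sideLength_one_of_eq (hl : la = lb) (hs : s ∈ Icc (0 : ℝ) 1)
    {T : PlaneTriangle} (hT : sideLength T = familySides w c s) :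
    sideLength T 0 = sideLength T 1 := by
  rw [hT]
  exact congrArg (shapeSide · (c s) s) (h.w_eq_half_of_eq hl hs)

lemma sideLength_lt_of_lt (hs : s ∈ Ioo (0 : ℝ) 1) (ht : t ∈ Ioo (0 : ℝ) 1) (hst : s < t)
    {T₁ T₂ : PlaneTriangle} (hT₁ : sideLength T₁ = familySides w c s)
    (hT₂ : sideLength T₂ = familySides w c t) :
    sideLength T₁ 0 < sideLength T₂ 0 ∧ sideLength T₁ 1 < sideLength T₂ 1 ∧
      sideLength T₂ 2 < sideLength T₁ 2 := by
  rw [hT₁, hT₂]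
  exact ⟨h.strictMonoOn_shapeSide (Ioo_subset_Ico_self hs) (Ioo_subset_Ico_self ht) hst,
    h.swap.strictMonoOn_shapeSide (Ioo_subset_Ico_self hs) (Ioo_subset_Ico_self ht) hst,
    h.strictAntiOn_c (Ioo_subset_Icc_self hs) (Ioo_subset_Icc_self ht) hst⟩

lemma not_congruent_comp (hs : s ∈ Ioo (0 : ℝ) 1) (ht : t ∈ Ioo (0 : ℝ) 1) (hst : s < t)
    {T₁ T₂ : PlaneTriangle} (hT₁ : sideLength T₁ = familySides w c s)
    (hT₂ : sideLength T₂ = familySides w c t) (σ : Equiv.Perm (Fin 3)) :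
    ¬ Congruent (T₁.points ∘ σ) T₂.points := by
  intro hcongr
  have hσ (i : Fin 3) : sideLength T₂ i = sideLength T₁ (σ i) :=
    (congrFun (sideLength_comp_of_congruent hcongr) i).symm
  obtain ⟨hA, hB, hC⟩ := h.sideLength_lt_of_lt hs ht hst hT₁ hT₂
  have hne : ∀ i, σ i ≠ i := Fin.forall_fin_succ.2 ⟨fun h₀ => hA.ne (by rw [hσ, h₀]),
    Fin.forall_fin_two.2 ⟨fun h₁ => hB.ne (by rw [hσ]; exact congrArg _ h₁.symm),
      fun h₂ => hC.ne (by rw [hσ]; exact congrArg _ h₂)⟩⟩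
  have hisosceles (hl : la = lb) : sideLength T₁ 0 = sideLength T₁ 1 :=
    h.sideLength_zero_eq_sideLength_one_of_eq hl (Ioo_subset_Icc_self hs) hT₁
  -- The rotation `σ` carries the bisector `la` of one triangle to the bisector `lb` of the other;
  -- hence `la = lb` and both triangles are isosceles.
  have h₁ := (h.hasBisectorLength_iff_exists T₁).2 ⟨s, hs, hT₁⟩
  have h₂ := (h.hasBisectorLength_iff_exists T₂).2 ⟨t, ht, hT₂⟩
  simp only [hasBisectorLength_iff, hσ] at h₁ h₂
  rcases perm_fin_three_of_forall_ne hne with ⟨h₀₁, h₁₂, h₂₀⟩ | ⟨h₀₂, h₁₀, h₂₁⟩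
  · simp only [Fin.isValue, Fin.reduceAdd, zero_add, h₀₁, h₁₂, h₂₀] at h₁ h₂
    have hl : la = lb := h₂.1.symm.trans h₁.2
    rw [hσ, h₀₁, hisosceles hl] at hA
    exact hA.false
  · simp only [Fin.isValue, Fin.reduceAdd, zero_add, h₀₂, h₁₀, h₂₁] at h₁ h₂
    have hl : la = lb := h₁.1.symm.trans h₂.2
    rw [hσ, h₁₀, hisosceles hl] at hB
    exact hB.false

lemma exactlyOne_trianglesWith (hF : IsElementAlong w c f F)
    (hx : (Ioo (0 : ℝ) 1 ∩ F ⁻¹' {x}).encard = 1) : ExactlyOne (trianglesWith la lb f x) := by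
  obtain ⟨s, hfiber⟩ := encard_eq_one.1 hx
  have hs : s ∈ Ioo (0 : ℝ) 1 ∩ F ⁻¹' {x} := hfiber ▸ mem_singleton s
  obtain ⟨T₁, hT₁⟩ := h.exists_triangle_sideLength_eq hs.1
  refine ⟨T₁, (h.mem_trianglesWith_iff hF).2 ⟨s, hs, hT₁⟩, fun T hT => ?_⟩
  obtain ⟨t, ht, hT⟩ := (h.mem_trianglesWith_iff hF).1 hT
  obtain rfl : t = s := by rwa [hfiber] at ht
  exact congruent_of_sideLength_eq (hT.trans hT₁.symm)

lemma exactlyTwo_trianglesWith (hF : IsElementAlong w c f F)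
    (hx : (Ioo (0 : ℝ) 1 ∩ F ⁻¹' {x}).encard = 2) : ExactlyTwo (trianglesWith la lb f x) := by
  obtain ⟨s, t, hne, hfiber⟩ := encard_eq_two.1 hx
  wlog hst : s < t generalizing s t
  · exact this t s hne.symm (hfiber.trans (pair_comm s t)) (hne.symm.lt_of_le (not_lt.1 hst))
  have hs : s ∈ Ioo (0 : ℝ) 1 ∩ F ⁻¹' {x} := hfiber ▸ mem_insert s {t}
  have ht : t ∈ Ioo (0 : ℝ) 1 ∩ F ⁻¹' {x} := hfiber ▸ mem_insert_of_mem s (mem_singleton t)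
  obtain ⟨T₁, hT₁⟩ := h.exists_triangle_sideLength_eq hs.1
  obtain ⟨T₂, hT₂⟩ := h.exists_triangle_sideLength_eq ht.1
  refine ⟨T₁, (h.mem_trianglesWith_iff hF).2 ⟨s, hs, hT₁⟩, T₂,
    (h.mem_trianglesWith_iff hF).2 ⟨t, ht, hT₂⟩, h.not_congruent_comp hs.1 ht.1 hst hT₁ hT₂,
    fun T hT => ?_⟩
  obtain ⟨u, hu, hT⟩ := (h.mem_trianglesWith_iff hF).1 hT
  rw [hfiber] at hu
  rcases hu with rfl | rfl
  · exact .inl (congruent_of_sideLength_eq (hT.trans hT₁.symm))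
  · exact .inr (congruent_of_sideLength_eq (hT.trans hT₂.symm))

lemma trianglesWith_eq_empty (hF : IsElementAlong w c f F)
    (hx : (Ioo (0 : ℝ) 1 ∩ F ⁻¹' {x}).encard = 0) : trianglesWith la lb f x = ∅ := by
  refine eq_empty_of_forall_notMem fun T hT => ?_
  obtain ⟨s, hs, -⟩ := (h.mem_trianglesWith_iff hF).1 hT
  exact (encard_eq_zero.1 hx).subset hs

end IsBisectorFamily

/-! ### Heights -/

section Height

variable {w c s l : ℝ}

lemma heightOfSides_comm (a b c : ℝ) : heightOfSides a b c = heightOfSides a c b := by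
  unfold heightOfSides
  congr 2
  ring

/-- `tan (B / 2)` in a triangle of shape `(w, s)`; then `tan (A / 2)` is `halfTan (1 - w) s`. -/
noncomputable def halfTan (w s : ℝ) : ℝ := √(s * (w / (1 - w)))

lemma halfTan_zero (w : ℝ) : halfTan w 0 = 0 := by
  rw [halfTan, zero_mul, Real.sqrt_zero]

lemma sq_halfTan (hw : w ∈ Ioo (0 : ℝ) 1) (hs : 0 ≤ s) : halfTan w s ^ 2 = s * (w / (1 - w)) :=
  Real.sq_sqrt (mul_nonneg hs (div_pos hw.1 (sub_pos.2 hw.2)).le)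

lemma one_add_sq_halfTan (hw : w ∈ Ioo (0 : ℝ) 1) (hs : 0 ≤ s) :
    1 + halfTan w s ^ 2 = (1 - w + s * w) / (1 - w) := by
  have := sub_pos.2 hw.2
  rw [sq_halfTan hw hs]
  field_simp

lemma halfTan_eq_mul_halfTan_one_sub (hw : w ∈ Ioo (0 : ℝ) 1) (s : ℝ) :
    halfTan w s = w / (1 - w) * halfTan (1 - w) s := by
  have hw₁ := sub_pos.2 hw.2
  have hw₀ := hw.1
  rw [halfTan, halfTan, sub_sub_cancel,
    ← Real.sqrt_sq (div_pos hw₀ hw₁).le, ← Real.sqrt_mul (sq_nonneg _),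
    Real.sqrt_sq (div_pos hw₀ hw₁).le]
  congr 1
  field_simp

lemma sqrt_heron_shapeSide (hw : w ∈ Ioo (0 : ℝ) 1) (hs : s ∈ Ico (0 : ℝ) 1) :
    √((shapeSide w c s + shapeSide (1 - w) c s + c) * (-shapeSide w c s + shapeSide (1 - w) c s + c)
      * (shapeSide w c s - shapeSide (1 - w) c s + c) *
        (shapeSide w c s + shapeSide (1 - w) c s - c)) =
      4 * c ^ 2 * (1 - w) / (1 - s) * halfTan w s := by
  have hw₁ := sub_pos.2 hw.2
  have hs₁ := sub_pos.2 hs.2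
  have hnonneg : 0 ≤ 4 * c ^ 2 * (1 - w) / (1 - s) * halfTan w s :=
    mul_nonneg (by positivity) (Real.sqrt_nonneg _)
  rw [← Real.sqrt_sq hnonneg, mul_pow, sq_halfTan hw hs.1]
  unfold shapeSide
  congr 1
  field_simp
  ring

lemma shapeSide_eq_mul_one_add_sq_halfTan (hw : w ∈ Ioo (0 : ℝ) 1) (hs : s ∈ Ico (0 : ℝ) 1) :
    shapeSide w c s = c * (1 - w) / (1 - s) * (1 + halfTan w s ^ 2) := by
  have hw₁ := sub_pos.2 hw.2
  have hs₁ := sub_pos.2 hs.2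
  rw [one_add_sq_halfTan hw hs.1, shapeSide]
  field_simp
  ring

/-- `sin θ` as a function of `tan (θ / 2)`. -/
noncomputable def sinOfHalfTan (u : ℝ) : ℝ := 2 * u / (1 + u ^ 2)

lemma sinOfHalfTan_zero : sinOfHalfTan 0 = 0 := by
  rw [sinOfHalfTan, mul_zero, zero_div]

lemma sinOfHalfTan_pos {u : ℝ} (hu : 0 < u) : 0 < sinOfHalfTan u := by
  unfold sinOfHalfTan
  positivity

lemma continuous_sinOfHalfTan : Continuous sinOfHalfTan :=
  (continuous_const.mul continuous_id).div (by fun_prop) fun u => by positivity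

lemma strictMonoOn_sinOfHalfTan : StrictMonoOn sinOfHalfTan (Icc 0 1) := by
  intro u hu v hv huv
  have : 0 < 1 - u * v := by nlinarith [hu.1, hv.2]
  refine (div_lt_div_iff₀ (by positivity) (by positivity)).2 ?_
  nlinarith [mul_pos (sub_pos.2 huv) this]

lemma heightOfSides_shapeSide (hw : w ∈ Ioo (0 : ℝ) 1) (hc : 0 < c) (hs : s ∈ Ico (0 : ℝ) 1) :
    heightOfSides (shapeSide w c s) (shapeSide (1 - w) c s) c =
      c * sinOfHalfTan (halfTan w s) := by
  have hw₁ := sub_pos.2 hw.2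
  have hs₁ := sub_pos.2 hs.2
  rw [heightOfSides, sqrt_heron_shapeSide hw hs, shapeSide_eq_mul_one_add_sq_halfTan hw hs,
    sinOfHalfTan]
  field_simp
  ring

lemma heightOfSides_base (hw : w ∈ Ioo (0 : ℝ) 1) (hc : 0 < c) (hs : s ∈ Ico (0 : ℝ) 1) :
    heightOfSides c (shapeSide w c s) (shapeSide (1 - w) c s) =
      shapeSide w c s * sinOfHalfTan (halfTan w s) := by
  have hw₁ := sub_pos.2 hw.2
  have hs₁ := sub_pos.2 hs.2
  have hrotate (a b : ℝ) : (c + a + b) * (-c + a + b) * (c - a + b) * (c + a - b) =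
      (a + b + c) * (-a + b + c) * (a - b + c) * (a + b - c) := by ring
  rw [heightOfSides, hrotate, sqrt_heron_shapeSide hw hs,
    shapeSide_eq_mul_one_add_sq_halfTan hw hs, sinOfHalfTan]
  field_simp
  ring

lemma sin_arctan_add_two_mul_arctan (u v : ℝ) : Real.sin (Real.arctan u + 2 * Real.arctan v) =
    (u * (1 - v ^ 2) + 2 * v) / (√(1 + u ^ 2) * (1 + v ^ 2)) := by
  have hv : √(1 + v ^ 2) ^ 2 = 1 + v ^ 2 := Real.sq_sqrt (by positivity)
  have : 0 < √(1 + v ^ 2) := by positivity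
  rw [Real.sin_add, Real.sin_two_mul, Real.cos_two_mul', Real.sin_arctan, Real.cos_arctan,
    Real.sin_arctan, Real.cos_arctan]
  field_simp
  rw [hv]

/-- The angle `A / 2 + B` of a triangle of shape `(w, s)`, which is an angle between the bisector
from `A` and the side `a`. -/
noncomputable def footAngle (w s : ℝ) : ℝ :=
  Real.arctan (halfTan (1 - w) s) + 2 * Real.arctan (halfTan w s)

lemma sqrt_mul_sin_footAngle (hw : w ∈ Ioo (0 : ℝ) 1) (hc : 0 < c) (hs : s ∈ Ico (0 : ℝ) 1) :
    √(c ^ 2 * bisectorRatioSq w s) * Real.sin (footAngle w s) =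
      c * sinOfHalfTan (halfTan w s) := by
  have hw' := Ioo.mem_iff_one_sub_mem.1 hw
  have hw₀ := hw.1
  have hw₁ := hw'.1
  have hs₁ := sub_pos.2 hs.2
  have hs₀ := hs.1
  set u := halfTan (1 - w) s with hu_def
  have hu : 1 + u ^ 2 = (w + s * (1 - w)) / w := by
    rw [one_add_sq_halfTan hw' hs.1, sub_sub_cancel]
  have hnum : u * (1 - halfTan w s ^ 2) + 2 * halfTan w s =
      u * (1 + (1 - s) * w) / (1 - w) := by
    rw [sq_halfTan hw hs.1, halfTan_eq_mul_halfTan_one_sub hw]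
    field_simp
    ring
  have hsqrt : √(c ^ 2 * bisectorRatioSq w s) =
      2 * c * w / (1 + (1 - s) * w) * √(1 + u ^ 2) := by
    rw [← Real.sqrt_sq (by positivity : 0 ≤ 2 * c * w / (1 + (1 - s) * w)),
      ← Real.sqrt_mul (sq_nonneg _), hu, bisectorRatioSq]
    congr 1
    field_simp
    ring
  have : 0 < √(1 + u ^ 2) := by positivity
  rw [footAngle, sin_arctan_add_two_mul_arctan, hsqrt, hnum, sinOfHalfTan,
    halfTan_eq_mul_halfTan_one_sub hw, ← hu_def]
  field_simp

lemma footAngle_zero (w : ℝ) : footAngle w 0 = 0 := by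
  rw [footAngle, halfTan_zero, halfTan_zero, Real.arctan_zero, mul_zero, add_zero]

lemma footAngle_one (hw : w ∈ Ioo (0 : ℝ) 1) :
    footAngle w 1 = Real.arctan (halfTan w 1) + Real.pi / 2 := by
  have hinv : halfTan (1 - w) 1 = (halfTan w 1)⁻¹ := by
    rw [halfTan, halfTan, one_mul, one_mul, sub_sub_cancel, ← Real.sqrt_inv, inv_div]
  have hpos : 0 < halfTan w 1 :=
    Real.sqrt_pos.2 (mul_pos one_pos (div_pos hw.1 (sub_pos.2 hw.2)))
  rw [footAngle, hinv, Real.arctan_inv_of_pos hpos]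
  ring

lemma encard_fiber_mul_sin {d : ℝ → ℝ} {a b : ℝ} (hl : 0 < l) (hd : ContinuousOn d (Icc a b))
    (hmono : StrictMonoOn d (Icc a b)) (hab : a ≤ b) (ha : d a = 0)
    (hb : d b ∈ Ioc (Real.pi / 2) Real.pi) (x : ℝ) :
    (Ioo a b ∩ (fun s => l * Real.sin (d s)) ⁻¹' {x}).encard =
      (Ioo 0 l).indicator 1 x + (Ioc (l * Real.sin (d b)) l).indicator 1 x := by
  have hpi := Real.pi_div_two_pos
  obtain ⟨m, hm, hdm⟩ : Real.pi / 2 ∈ d '' Ioo a b :=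
    intermediate_value_Ioo hab hd ⟨ha.trans_lt hpi, hb.1⟩
  have hm' := Ioo_subset_Icc_self hm
  have hleft : StrictMonoOn (fun s => l * Real.sin (d s)) (Icc a m) := by
    have hsub : Icc a m ⊆ Icc a b := Icc_subset_Icc_right hm'.2
    refine (strictMono_mul_left_of_pos hl).comp_strictMonoOn
      (Real.strictMonoOn_sin.comp (hmono.mono hsub) fun s hs => ⟨?_, ?_⟩)
    · have := hmono.monotoneOn (left_mem_Icc.2 hab) (hsub hs) hs.1
      linarith
    · exact hdm ▸ hmono.monotoneOn (hsub hs) hm' hs.2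
  have hright : StrictAntiOn (fun s => l * Real.sin (d s)) (Icc m b) := by
    intro s hs t ht hst
    have hsub : Icc m b ⊆ Icc a b := Icc_subset_Icc_left hm'.1
    have hms := hmono.monotoneOn hm' (hsub hs) hs.1
    have htb := hmono.monotoneOn (hsub ht) (right_mem_Icc.2 hab) ht.2
    have hst' := hmono (hsub hs) (hsub ht) hst
    have hcos := Real.strictAntiOn_cos (a := d s - Real.pi / 2) (b := d t - Real.pi / 2)
      ⟨by linarith, by linarith [hb.2]⟩ ⟨by linarith, by linarith [hb.2]⟩ (by linarith)
    rw [Real.cos_sub_pi_div_two, Real.cos_sub_pi_div_two] at hcos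
    exact mul_lt_mul_of_pos_left hcos hl
  have hcont : ContinuousOn (fun s => l * Real.sin (d s)) (Icc a b) :=
    continuousOn_const.mul (Real.continuous_sin.comp_continuousOn hd)
  rw [encard_fiber_of_strictMonoOn_strictAntiOn hm hcont hleft hright, ha, hdm,
    Real.sin_zero, mul_zero, Real.sin_pi_div_two, mul_one]

lemma hStarStar_comm (la lb : ℝ) : hStarStar la lb = hStarStar lb la := by
  rw [hStarStar, hStarStar, mul_comm, add_comm]

lemma hStarStar_pos {la lb : ℝ} (hla : 0 < la) (hlb : 0 < lb) : 0 < hStarStar la lb := by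
  unfold hStarStar
  positivity

lemma hStarStar_lt_left {la lb : ℝ} (hla : 0 < la) (hlb : 0 < lb) : hStarStar la lb < la := by
  rw [hStarStar, mul_div_assoc]
  refine mul_lt_of_lt_one_right hla ((div_lt_one (by positivity)).2 ?_)
  exact Real.lt_sqrt_of_sq_lt (lt_add_of_pos_left _ (pow_pos hla 2))

end Height

namespace IsBisectorFamily

variable {la lb s : ℝ} {w c : ℝ → ℝ} (h : IsBisectorFamily la lb w c)
include h

lemma strictMonoOn_halfTan : StrictMonoOn (fun s => halfTan (w s) s) (Icc 0 1) :=
  fun s hs _ ht hst => Real.sqrt_lt_sqrt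
    (mul_nonneg hs.1 (div_pos (h.w_mem s hs).1 (sub_pos.2 (h.w_mem s hs).2)).le)
    (h.strictMonoOn_mul_div hs ht hst)

lemma continuousOn_halfTan : ContinuousOn (fun s => halfTan (w s) s) (Icc 0 1) :=
  (continuousOn_id.mul (h.continuousOn_w.div (continuousOn_const.sub h.continuousOn_w)
    fun s hs => (sub_pos.2 (h.w_mem s hs).2).ne')).sqrt

lemma strictMonoOn_footAngle : StrictMonoOn (fun s => footAngle (w s) s) (Icc 0 1) :=
  fun _ hs _ ht hst => add_lt_add (Real.arctan_strictMono (h.swap.strictMonoOn_halfTan hs ht hst))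
    (mul_lt_mul_of_pos_left (Real.arctan_strictMono (h.strictMonoOn_halfTan hs ht hst)) two_pos)

lemma continuousOn_footAngle : ContinuousOn (fun s => footAngle (w s) s) (Icc 0 1) :=
  (Real.continuous_arctan.comp_continuousOn h.swap.continuousOn_halfTan).add
    (continuousOn_const.mul (Real.continuous_arctan.comp_continuousOn h.continuousOn_halfTan))

lemma halfTan_one : halfTan (w 1) 1 = la / lb := by
  have h₁ : (1 : ℝ) ∈ Icc (0 : ℝ) 1 := right_mem_Icc.2 zero_le_one
  have hw₁ := sub_pos.2 (h.w_mem 1 h₁).2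
  have hc := h.c_pos 1 h₁
  rw [← Real.sqrt_sq (div_pos h.left_pos h.right_pos).le, div_pow, ← h.left_eq 1 h₁,
    ← h.right_eq 1 h₁, halfTan, bisectorRatioSq, bisectorRatioSq]
  congr 1
  field_simp
  ring

lemma mul_sin_footAngle_one : la * Real.sin (footAngle (w 1) 1) = hStarStar la lb := by
  have hla := h.left_pos
  have hlb := h.right_pos
  have hsum : 1 + (la / lb) ^ 2 = (la ^ 2 + lb ^ 2) / lb ^ 2 := by
    field_simp
    ring
  rw [footAngle_one (h.w_mem 1 (right_mem_Icc.2 zero_le_one)), Real.sin_add_pi_div_two,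
    Real.cos_arctan, h.halfTan_one, hsum, Real.sqrt_div (by positivity), Real.sqrt_sq hlb.le,
    hStarStar]
  field_simp

lemma encard_height_left (x : ℝ) :
    (Ioo 0 1 ∩ (fun s => la * Real.sin (footAngle (w s) s)) ⁻¹' {x}).encard =
      (Ioo 0 la).indicator 1 x + (Ioc (hStarStar la lb) la).indicator 1 x := by
  have hone : footAngle (w 1) 1 ∈ Ioc (Real.pi / 2) Real.pi := by
    rw [footAngle_one (h.w_mem 1 (right_mem_Icc.2 zero_le_one)), h.halfTan_one]
    have := Real.arctan_lt_pi_div_two (la / lb)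
    have := Real.arctan_pos.2 (div_pos h.left_pos h.right_pos)
    constructor <;> linarith
  rw [← h.mul_sin_footAngle_one]
  exact encard_fiber_mul_sin h.left_pos h.continuousOn_footAngle h.strictMonoOn_footAngle
    zero_le_one (footAngle_zero _) hone x

lemma encard_height_right (x : ℝ) :
    (Ioo 0 1 ∩ (fun s => lb * Real.sin (footAngle (1 - w s) s)) ⁻¹' {x}).encard =
      (Ioo 0 lb).indicator 1 x + (Ioc (hStarStar la lb) lb).indicator 1 x := by
  rw [hStarStar_comm]
  exact h.swap.encard_height_left x

lemma heightOfSides_eq_mul_sin (hs : s ∈ Ioo (0 : ℝ) 1) :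
    heightOfSides (shapeSide (w s) (c s) s) (shapeSide (1 - w s) (c s) s) (c s) =
      la * Real.sin (footAngle (w s) s) := by
  have hs' := Ioo_subset_Ico_self hs
  have hs'' := Ioo_subset_Icc_self hs
  rw [heightOfSides_shapeSide (h.w_mem s hs'') (h.c_pos s hs'') hs',
    ← sqrt_mul_sin_footAngle (h.w_mem s hs'') (h.c_pos s hs'') hs', h.left_eq s hs'',
    Real.sqrt_sq h.left_pos.le]

lemma isElementAlong_height_zero : IsElementAlong w c (fun T => T.height 0)
    (fun s => la * Real.sin (footAngle (w s) s)) := by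
  intro s hs T hT
  dsimp only
  rw [← h.heightOfSides_eq_mul_sin hs, height_eq_heightOfSides, hT]
  rfl

lemma isElementAlong_height_one : IsElementAlong w c (fun T => T.height 1)
    (fun s => lb * Real.sin (footAngle (1 - w s) s)) := by
  intro s hs T hT
  dsimp only
  have := h.swap.heightOfSides_eq_mul_sin hs
  rw [sub_sub_cancel] at this
  rw [← this, height_eq_heightOfSides, hT, heightOfSides_comm]
  rfl

lemma isElementAlong_height_two : IsElementAlong w c (fun T => T.height 2) (fun s =>
    shapeSide (w s) (c s) s * sinOfHalfTan (halfTan (w s) s)) := by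
  intro s hs T hT
  dsimp only
  have hs' := Ioo_subset_Icc_self hs
  rw [← heightOfSides_base (h.w_mem s hs') (h.c_pos s hs') (Ioo_subset_Ico_self hs),
    height_eq_heightOfSides, hT]
  rfl

lemma w_le_one_sub_w (hl : la ≤ lb) (hs : s ∈ Icc (0 : ℝ) 1) : w s ≤ 1 - w s := by
  by_contra! hlt
  have hw := Ioo_subset_Icc_self (h.w_mem s hs)
  have hratio := strictMonoOn_bisectorRatioSq_left hs (Icc.mem_iff_one_sub_mem.1 hw) hw hlt
  have := mul_lt_mul_of_pos_left hratio (pow_pos (h.c_pos s hs) 2)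
  rw [h.left_eq s hs, h.right_eq s hs] at this
  exact this.not_ge (pow_le_pow_left₀ h.left_pos.le hl 2)

lemma halfTan_le_one (hl : la ≤ lb) (hs : s ∈ Icc (0 : ℝ) 1) : halfTan (w s) s ≤ 1 := by
  have hw₁ := sub_pos.2 (h.w_mem s hs).2
  exact Real.sqrt_le_one.2 (mul_le_one₀ hs.2 (div_pos (h.w_mem s hs).1 hw₁).le
    ((div_le_one hw₁).2 (h.w_le_one_sub_w hl hs)))

lemma encard_height_base (hl : la ≤ lb) (x : ℝ) :
    (Ioo 0 1 ∩ (fun s => shapeSide (w s) (c s) s * sinOfHalfTan (halfTan (w s) s)) ⁻¹' {x}).encard =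
        (Ioi 0).indicator 1 x := by
  have hsin_cont : ContinuousOn (fun s => sinOfHalfTan (halfTan (w s) s)) (Icc 0 1) :=
    continuous_sinOfHalfTan.comp_continuousOn h.continuousOn_halfTan
  have hsin_mono : StrictMonoOn (fun s => sinOfHalfTan (halfTan (w s) s)) (Icc 0 1) :=
    strictMonoOn_sinOfHalfTan.comp h.strictMonoOn_halfTan fun s hs =>
      ⟨Real.sqrt_nonneg _, h.halfTan_le_one hl hs⟩
  have hsin_zero : sinOfHalfTan (halfTan (w 0) 0) = 0 := by
    rw [halfTan_zero, sinOfHalfTan_zero]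
  have hsin_one : 0 < sinOfHalfTan (halfTan (w 1) 1) := by
    rw [h.halfTan_one]
    exact sinOfHalfTan_pos (div_pos h.left_pos h.right_pos)
  have hcont : ContinuousOn (fun s => shapeSide (w s) (c s) s * sinOfHalfTan (halfTan (w s) s))
      (Ico 0 1) :=
    h.continuousOn_shapeSide.mul (hsin_cont.mono Ico_subset_Icc_self)
  have hmono : StrictMonoOn (fun s => shapeSide (w s) (c s) s * sinOfHalfTan (halfTan (w s) s))
      (Ico 0 1) := fun s hs t ht hst =>
    mul_lt_mul'' (h.strictMonoOn_shapeSide hs ht hst)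
      (hsin_mono (Ico_subset_Icc_self hs) (Ico_subset_Icc_self ht) hst)
      (h.shapeSide_pos hs).le (hsin_zero.symm.trans_le
        (hsin_mono.monotoneOn (left_mem_Icc.2 zero_le_one) (Ico_subset_Icc_self hs) hs.1))
  have htop := h.tendsto_shapeSide_atTop.atTop_mul_pos hsin_one
    (tendsto_nhdsLT_of_continuousOn_Icc zero_lt_one hsin_cont)
  rw [encard_fiber_of_strictMonoOn zero_lt_one hcont hmono htop, hsin_zero, mul_zero]

end IsBisectorFamily

/-! ### Medians -/

section Median

variable {a b c l : ℝ}

lemma medianOfSides_comm (a b c : ℝ) : medianOfSides a b c = medianOfSides a c b := by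
  rw [medianOfSides, medianOfSides, add_comm (2 * b ^ 2)]

lemma medianOfSides_self_add (ha : 0 ≤ a) (hb : 0 ≤ b) : medianOfSides a b (a + b) = b + a / 2 := by
  have hsq : 2 * b ^ 2 + 2 * (a + b) ^ 2 - a ^ 2 = (2 * b + a) ^ 2 := by ring
  rw [medianOfSides, hsq, Real.sqrt_sq (by positivity)]
  ring

lemma medianOfSides_add (hba : b ≤ a) : medianOfSides (a + b) a b = (a - b) / 2 := by
  have hsq : 2 * a ^ 2 + 2 * b ^ 2 - (a + b) ^ 2 = (a - b) ^ 2 := by ring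
  rw [medianOfSides, hsq, Real.sqrt_sq (sub_nonneg.2 hba)]

/-- The median from `A` as a function of the bisector `l` from `A` and the sides `b`, `c`. -/
noncomputable def medianOfBisector (l b c : ℝ) : ℝ :=
  √(4 * l ^ 2 + (b - c) ^ 2 + l ^ 2 * ((b - c) ^ 2 / (b * c))) / 2

lemma medianOfSides_eq_medianOfBisector (hb : 0 < b) (hc : 0 < c) (hl : 0 < l)
    (h : bisectorOfSides a b c = l) : medianOfSides a b c = medianOfBisector l b c := by
  rw [bisectorOfSides, Real.sqrt_eq_iff_mul_self_eq_of_pos hl] at h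
  rw [medianOfSides, medianOfBisector, sq l, h]
  congr 2
  field_simp
  ring

lemma medianOfBisector_comm (l b c : ℝ) : medianOfBisector l b c = medianOfBisector l c b := by
  rw [medianOfBisector, medianOfBisector, ← neg_sq (b - c), neg_sub, mul_comm b]

lemma medianOfBisector_self (hl : 0 ≤ l) (b : ℝ) : medianOfBisector l b b = l := by
  have hsq : 4 * l ^ 2 + (b - b) ^ 2 + l ^ 2 * ((b - b) ^ 2 / (b * b)) = (2 * l) ^ 2 := by ring
  rw [medianOfBisector, hsq, Real.sqrt_sq (by positivity)]
  ring

lemma sq_sub_div_mul_lt {b' c' : ℝ} (hb : 0 < b) (hbb : b < b') (hbc : b' ≤ c') (hcc : c' < c) :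
    (b' - c') ^ 2 / (b' * c') < (b - c) ^ 2 / (b * c) := by
  have hb' := hb.trans hbb
  have hc' := hb'.trans_le hbc
  have hc := hc'.trans hcc
  have hfactor {x y : ℝ} (hx : 0 < x) (hy : 0 < y) :
      (x - y) ^ 2 / (x * y) = (y / x - 1) * (1 - x / y) := by
    field_simp
    ring
  rw [hfactor hb' hc', hfactor hb hc]
  refine mul_lt_mul'' (sub_lt_sub_right ?_ 1) (sub_lt_sub_left ?_ 1)
    (sub_nonneg.2 ((one_le_div hb').2 hbc)) (sub_nonneg.2 ((div_le_one hc').2 hbc))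
  · exact div_lt_div₀ hcc hbb.le hc.le hb
  · exact div_lt_div₀ hbb hcc.le hb'.le hc'

lemma medianOfBisector_lt {b' c' : ℝ} (hl : 0 < l) (hb : 0 < b) (hbb : b < b') (hbc : b' ≤ c')
    (hcc : c' < c) : medianOfBisector l b' c' < medianOfBisector l b c := by
  have hdiff : (b' - c') ^ 2 < (b - c) ^ 2 := sq_lt_sq.2 (by
    rw [abs_of_nonpos (by linarith), abs_of_neg (by linarith)]
    linarith)
  have hquot := mul_lt_mul_of_pos_left (sq_sub_div_mul_lt hb hbb hbc hcc) (pow_pos hl 2)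
  have := hb.trans hbb
  have := this.trans_le hbc
  exact div_lt_div_of_pos_right (Real.sqrt_lt_sqrt (by positivity) (by linarith)) two_pos

lemma sub_div_two_le_medianOfBisector (l : ℝ) (hb : 0 ≤ b) (hc : 0 ≤ c) :
    (b - c) / 2 ≤ medianOfBisector l b c := by
  refine div_le_div_of_nonneg_right (Real.le_sqrt_of_sq_le ?_) zero_le_two
  have : 0 ≤ l ^ 2 * ((b - c) ^ 2 / (b * c)) := by positivity
  linarith [sq_nonneg l]

lemma cStar_comm (la lb : ℝ) : cStar la lb = cStar lb la := by
  rw [cStar, cStar, add_comm la, add_comm (la ^ 2), mul_comm la]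

lemma bStar_swap (la lb : ℝ) : bStar lb la = aStar la lb := by
  rw [bStar, aStar, cStar_comm]

lemma maStar_swap (la lb : ℝ) : maStar lb la = mbStar la lb := by
  rw [maStar, mbStar, bStar_swap, ← bStar_swap lb la]

variable {f g : ℝ → ℝ} {s₀ s₁ : ℝ}

lemma tendsto_sub_atTop_of_antitoneOn (hs : s₀ < s₁) (hg : AntitoneOn g (Ico s₀ s₁))
    (hf : Tendsto f (𝓝[<] s₁) atTop) : Tendsto (fun s => f s - g s) (𝓝[<] s₁) atTop := by
  refine tendsto_atTop_mono' _ ?_ (tendsto_atTop_add_const_right _ (-g s₀) hf)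
  filter_upwards [Ico_mem_nhdsLT hs] with s hs'
  linarith [hg (left_mem_Ico.2 hs) hs' hs'.1]

lemma exists_mem_Ioo_eq_of_tendsto_sub_atTop (hs : s₀ < s₁) (hf : ContinuousOn f (Ico s₀ s₁))
    (hg : ContinuousOn g (Ico s₀ s₁)) (hfg : f s₀ < g s₀)
    (htop : Tendsto (fun s => f s - g s) (𝓝[<] s₁) atTop) : ∃ m ∈ Ioo s₀ s₁, f m = g m := by
  have : (𝓝[<] s₁).NeBot := nhdsLT_neBot_of_exists_lt ⟨s₀, hs⟩
  obtain ⟨m, hm, hfgm⟩ : (0 : ℝ) ∈ (fun s => f s - g s) '' Ico s₀ s₁ :=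
    isPreconnected_Ico.intermediate_value_Ici (left_mem_Ico.2 hs)
      (le_principal_iff.2 (Ico_mem_nhdsLT hs)) (hf.sub hg) htop (sub_neg.2 hfg).le
  exact ⟨m, ⟨hm.1.lt_of_ne fun h₀ => hfg.ne (sub_eq_zero.1 (h₀ ▸ hfgm)), hm.2⟩,
    sub_eq_zero.1 hfgm⟩

lemma continuousOn_medianOfBisector {S : Set ℝ} (l : ℝ) (hf : ContinuousOn f S)
    (hg : ContinuousOn g S) (hf_pos : ∀ s ∈ S, 0 < f s) (hg_pos : ∀ s ∈ S, 0 < g s) :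
    ContinuousOn (fun s => medianOfBisector l (f s) (g s)) S := by
  unfold medianOfBisector
  exact ((((hf.sub hg).pow 2).const_add _).add (continuousOn_const.mul (((hf.sub hg).pow 2).div
    (hf.mul hg) fun s hs => (mul_pos (hf_pos s hs) (hg_pos s hs)).ne'))).sqrt.div_const 2

lemma strictAntiOn_medianOfBisector {S : Set ℝ} (hl : 0 < l) (hf : StrictMonoOn f S)
    (hg : StrictAntiOn g S) (hf_pos : ∀ s ∈ S, 0 < f s) (hfg : ∀ s ∈ S, f s ≤ g s) :
    StrictAntiOn (fun s => medianOfBisector l (f s) (g s)) S := fun s hs t ht hst =>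
  medianOfBisector_lt hl (hf_pos s hs) (hf hs ht hst) (hfg t ht) (hg hs ht hst)

lemma strictMonoOn_medianOfBisector {S : Set ℝ} (hl : 0 < l) (hf : StrictMonoOn f S)
    (hg : StrictAntiOn g S) (hg_pos : ∀ s ∈ S, 0 < g s) (hgf : ∀ s ∈ S, g s ≤ f s) :
    StrictMonoOn (fun s => medianOfBisector l (f s) (g s)) S := fun s hs t ht hst => by
  simp only [medianOfBisector_comm l (f _)]
  exact medianOfBisector_lt hl (hg_pos t ht) (hg hs ht hst) (hgf s hs) (hf hs ht hst)

lemma encard_fiber_medianOfBisector (hs : s₀ < s₁) (hl : 0 < l)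
    (hf : ContinuousOn f (Ico s₀ s₁)) (hg : ContinuousOn g (Ico s₀ s₁))
    (hf_mono : StrictMonoOn f (Ico s₀ s₁)) (hg_anti : StrictAntiOn g (Ico s₀ s₁))
    (hf_pos : ∀ s ∈ Ico s₀ s₁, 0 < f s) (hg_pos : ∀ s ∈ Ico s₀ s₁, 0 < g s)
    (hf_top : Tendsto f (𝓝[<] s₁) atTop) (hfg : f s₀ < g s₀) (x : ℝ) :
    (Ioo s₀ s₁ ∩ (fun s => medianOfBisector l (f s) (g s)) ⁻¹' {x}).encard =
      (Ioo l (medianOfBisector l (f s₀) (g s₀))).indicator 1 x + (Ici l).indicator 1 x := by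
  have hsub_top := tendsto_sub_atTop_of_antitoneOn hs hg_anti.antitoneOn hf_top
  obtain ⟨m, hm, hfgm⟩ := exists_mem_Ioo_eq_of_tendsto_sub_atTop hs hf hg hfg hsub_top
  have hm' := Ioo_subset_Ico_self hm
  have hleft : Icc s₀ m ⊆ Ico s₀ s₁ := Icc_subset_Ico_right hm.2
  have hright : Ico m s₁ ⊆ Ico s₀ s₁ := Ico_subset_Ico_left hm.1.le
  have hle : ∀ s ∈ Icc s₀ m, f s ≤ g s := fun s hs' =>
    (hf_mono.monotoneOn (hleft hs') hm' hs'.2).trans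
      (hfgm.trans_le (hg_anti.antitoneOn (hleft hs') hm' hs'.2))
  have hge : ∀ s ∈ Ico m s₁, g s ≤ f s := fun s hs' =>
    (hg_anti.antitoneOn hm' (hright hs') hs'.1).trans
      (hfgm.symm.trans_le (hf_mono.monotoneOn hm' (hright hs') hs'.1))
  have htop : Tendsto (fun s => medianOfBisector l (f s) (g s)) (𝓝[<] s₁) atTop := by
    refine tendsto_atTop_mono' _ ?_ (hsub_top.atTop_div_const two_pos)
    filter_upwards [Ico_mem_nhdsLT hs] with s hs'
    exact sub_div_two_le_medianOfBisector l (hf_pos s hs').le (hg_pos s hs').le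
  rw [encard_fiber_of_strictAntiOn_strictMonoOn hm
    (continuousOn_medianOfBisector l hf hg hf_pos hg_pos)
    (strictAntiOn_medianOfBisector hl (hf_mono.mono hleft) (hg_anti.mono hleft)
      (fun s hs' => hf_pos s (hleft hs')) hle)
    (strictMonoOn_medianOfBisector hl (hf_mono.mono hright) (hg_anti.mono hright)
      (fun s hs' => hg_pos s (hright hs')) hge) htop,
    hfgm, medianOfBisector_self hl.le]

lemma tendsto_medianOfSides_atTop {α : Type*} {L : Filter α} {f g k : α → ℝ} {z : ℝ}
    (hf : Tendsto f L (𝓝 z)) (hg : Tendsto g L atTop) (hk : Tendsto k L atTop) :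
    Tendsto (fun s => medianOfSides (f s) (g s) (k s)) L atTop := by
  have hsq {u : α → ℝ} (hu : Tendsto u L atTop) : Tendsto (fun s => 2 * u s ^ 2) L atTop :=
    ((tendsto_pow_atTop two_ne_zero).comp hu).const_mul_atTop two_pos
  exact (Real.tendsto_sqrt_atTop.comp
    (((hsq hg).atTop_add_atTop (hsq hk)).atTop_add (hf.pow 2).neg)).atTop_div_const two_pos

lemma medianOfSides_lt_medianOfSides {a' b' c' : ℝ} (ha' : 0 ≤ a') (haa : a' < a) (hb : 0 ≤ b)
    (hbb : b < b') (hc : 0 ≤ c) (hcc : c < c') (habc : a ≤ b + c) :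
    medianOfSides a b c < medianOfSides a' b' c' := by
  have hasq : a' ^ 2 < a ^ 2 := pow_lt_pow_left₀ haa ha' two_ne_zero
  have hbsq : b ^ 2 < b' ^ 2 := pow_lt_pow_left₀ hbb hb two_ne_zero
  have hcsq : c ^ 2 < c' ^ 2 := pow_lt_pow_left₀ hcc hc two_ne_zero
  have hsum : a ^ 2 ≤ (b + c) ^ 2 := pow_le_pow_left₀ (ha'.trans haa.le) habc 2
  refine div_lt_div_of_pos_right (Real.sqrt_lt_sqrt ?_ (by linarith)) two_pos
  linarith [sq_nonneg (b - c)]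

lemma isElementAlong_median_two (w c : ℝ → ℝ) :
    IsElementAlong w c (fun T => medianLength T 2)
    (fun s => medianOfSides (c s) (shapeSide (w s) (c s) s) (shapeSide (1 - w s) (c s) s)) := by
  intro s _ T hT
  dsimp only
  rw [medianLength_eq_medianOfSides, hT]
  rfl

end Median

namespace IsBisectorFamily

variable {la lb s : ℝ} {w c : ℝ → ℝ} (h : IsBisectorFamily la lb w c)
include h

lemma bisectorOfSides_eq_left (hs : s ∈ Ico (0 : ℝ) 1) :
    bisectorOfSides (shapeSide (w s) (c s) s) (shapeSide (1 - w s) (c s) s) (c s) = la := by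
  have hs' := Ico_subset_Icc_self hs
  rw [bisectorOfSides_shapeSide (h.w_mem s hs').1 (h.c_pos s hs') hs, h.left_eq s hs',
    Real.sqrt_sq h.left_pos.le]

lemma medianOfSides_eq_left (hs : s ∈ Ico (0 : ℝ) 1) :
    medianOfSides (shapeSide (w s) (c s) s) (shapeSide (1 - w s) (c s) s) (c s) =
      medianOfBisector la (shapeSide (1 - w s) (c s) s) (c s) :=
  medianOfSides_eq_medianOfBisector (h.swap.shapeSide_pos hs)
    (h.c_pos s (Ico_subset_Icc_self hs)) h.left_pos (h.bisectorOfSides_eq_left hs)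

lemma isElementAlong_median_zero : IsElementAlong w c (fun T => medianLength T 0)
    (fun s => medianOfBisector la (shapeSide (1 - w s) (c s) s) (c s)) := by
  intro s hs T hT
  dsimp only
  rw [← h.medianOfSides_eq_left (Ioo_subset_Ico_self hs), medianLength_eq_medianOfSides, hT]
  rfl

lemma isElementAlong_median_one : IsElementAlong w c (fun T => medianLength T 1)
    (fun s => medianOfBisector lb (shapeSide (w s) (c s) s) (c s)) := by
  intro s hs T hT
  have hmedian := h.swap.medianOfSides_eq_left (Ioo_subset_Ico_self hs)
  rw [sub_sub_cancel] at hmedian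
  dsimp only
  rw [← hmedian, medianLength_eq_medianOfSides, hT, medianOfSides_comm]
  rfl

lemma mul_one_add_w_zero : la * (1 + w 0) = 2 * c 0 * w 0 := by
  have h₀ : (0 : ℝ) ∈ Icc (0 : ℝ) 1 := left_mem_Icc.2 zero_le_one
  have hw := (h.w_mem 0 h₀).1
  have hc := h.c_pos 0 h₀
  have hla := h.left_pos
  refine (pow_left_inj₀ (by positivity) (by positivity) two_ne_zero).1 ?_
  rw [mul_pow la, ← h.left_eq 0 h₀, bisectorRatioSq]
  field_simp
  ring

lemma c_zero : c 0 = cStar la lb := by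
  have h₀ : (0 : ℝ) ∈ Icc (0 : ℝ) 1 := left_mem_Icc.2 zero_le_one
  have hw := h.w_mem 0 h₀
  have hc := h.c_pos 0 h₀
  have hA := h.mul_one_add_w_zero
  have hB := h.swap.mul_one_add_w_zero
  have hla : la < c 0 := by nlinarith [mul_pos hc hw.1, mul_pos hc (sub_pos.2 hw.2), hw.1]
  have hlb : lb < c 0 := by nlinarith [mul_pos hc hw.1, mul_pos hc (sub_pos.2 hw.2), hw.2]
  have hquadratic : la ^ 2 + lb ^ 2 - la * lb = (2 * c 0 - la - lb) ^ 2 := by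
    have hA' : (2 * c 0 - la) * w 0 = la := by linear_combination -hA
    have hB' : (2 * c 0 - lb) * (1 - w 0) = lb := by linear_combination -hB
    linear_combination -(2 * c 0 - lb) * hA' - (2 * c 0 - la) * hB'
  have hsqrt : √(la ^ 2 + lb ^ 2 - la * lb) = 2 * c 0 - la - lb := by
    rw [hquadratic, Real.sqrt_sq (by linarith)]
  rw [cStar, hsqrt]
  ring

lemma mul_w_zero : c 0 * w 0 = bStar la lb := by
  have h₀ : (0 : ℝ) ∈ Icc (0 : ℝ) 1 := left_mem_Icc.2 zero_le_one
  have hA := h.mul_one_add_w_zero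
  have hla := h.left_pos
  have hw := (h.w_mem 0 h₀).1
  have hden : 2 * c 0 / la - 1 = 1 / w 0 := by
    field_simp
    linear_combination -hA
  rw [bStar, ← h.c_zero, hden, div_div_eq_mul_div, div_one]

lemma mul_one_sub_w_zero : c 0 * (1 - w 0) = aStar la lb := by
  rw [h.swap.mul_w_zero, bStar_swap]

lemma shapeSide_left_zero : shapeSide (w 0) (c 0) 0 = aStar la lb := by
  rw [shapeSide, sub_zero, div_one, h.mul_one_sub_w_zero]

lemma shapeSide_right_zero : shapeSide (1 - w 0) (c 0) 0 = bStar la lb := by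
  rw [shapeSide, sub_zero, div_one, sub_sub_cancel, h.mul_w_zero]

lemma aStar_add_bStar : aStar la lb + bStar la lb = c 0 := by
  rw [← h.mul_w_zero, ← h.mul_one_sub_w_zero]
  ring

lemma aStar_pos : 0 < aStar la lb :=
  h.shapeSide_left_zero ▸ h.shapeSide_pos (left_mem_Ico.2 zero_lt_one)

lemma bStar_pos : 0 < bStar la lb :=
  h.shapeSide_right_zero ▸ h.swap.shapeSide_pos (left_mem_Ico.2 zero_lt_one)

lemma medianOfBisector_zero :
    medianOfBisector la (shapeSide (1 - w 0) (c 0) 0) (c 0) = maStar la lb := by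
  rw [← h.medianOfSides_eq_left (left_mem_Ico.2 zero_lt_one), h.shapeSide_left_zero,
    h.shapeSide_right_zero, ← h.aStar_add_bStar,
    medianOfSides_self_add h.aStar_pos.le h.bStar_pos.le, maStar]

lemma encard_median_left (x : ℝ) :
    (Ioo 0 1 ∩ (fun s => medianOfBisector la (shapeSide (1 - w s) (c s) s) (c s)) ⁻¹' {x}).encard =
      (Ioo la (maStar la lb)).indicator 1 x + (Ici la).indicator 1 x := by
  have hzero : shapeSide (1 - w 0) (c 0) 0 < c 0 := by
    rw [h.shapeSide_right_zero, ← h.aStar_add_bStar]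
    exact lt_add_of_pos_left _ h.aStar_pos
  rw [← h.medianOfBisector_zero]
  exact encard_fiber_medianOfBisector zero_lt_one h.left_pos h.swap.continuousOn_shapeSide
    (h.continuousOn_c.mono Ico_subset_Icc_self) h.swap.strictMonoOn_shapeSide
    (h.strictAntiOn_c.mono Ico_subset_Icc_self) (fun _ => h.swap.shapeSide_pos)
    (fun s hs => h.c_pos s (Ico_subset_Icc_self hs)) h.swap.tendsto_shapeSide_atTop hzero x

lemma left_lt_maStar : la < maStar la lb := by
  have h₀ : (0 : ℝ) ∈ Icc (0 : ℝ) 1 := left_mem_Icc.2 zero_le_one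
  have hw := h.w_mem 0 h₀
  have hgap : (1 + w 0) * (maStar la lb - la) = c 0 * (1 - w 0) ^ 2 / 2 := by
    rw [maStar, ← h.mul_w_zero, ← h.mul_one_sub_w_zero]
    linear_combination -h.mul_one_add_w_zero
  have hpos : 0 < c 0 * (1 - w 0) ^ 2 / 2 :=
    half_pos (mul_pos (h.c_pos 0 h₀) (pow_pos (sub_pos.2 hw.2) 2))
  exact sub_pos.1 (pos_of_mul_pos_right (hgap ▸ hpos) (by linarith [hw.1]))

lemma right_lt_mbStar : lb < mbStar la lb :=
  maStar_swap la lb ▸ h.swap.left_lt_maStar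

lemma encard_median_right (x : ℝ) :
    (Ioo 0 1 ∩ (fun s => medianOfBisector lb (shapeSide (w s) (c s) s) (c s)) ⁻¹' {x}).encard =
      (Ioo lb (mbStar la lb)).indicator 1 x + (Ici lb).indicator 1 x := by
  simpa only [sub_sub_cancel, maStar_swap] using h.swap.encard_median_left x

lemma le_shapeSide_add_shapeSide (hs : s ∈ Ico (0 : ℝ) 1) :
    c s ≤ shapeSide (w s) (c s) s + shapeSide (1 - w s) (c s) s := by
  have hinv : 1 ≤ 1 / (1 - s) := (one_le_div (sub_pos.2 hs.2)).2 (sub_le_self 1 hs.1)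
  have := mul_le_mul_of_nonneg_left hinv (h.c_pos s (Ico_subset_Icc_self hs)).le
  unfold shapeSide
  linarith

lemma encard_median_base (hl : la ≤ lb) (x : ℝ) :
    (Ioo 0 1 ∩ (fun s => medianOfSides (c s) (shapeSide (w s) (c s) s)
      (shapeSide (1 - w s) (c s) s)) ⁻¹' {x}).encard = (Ioi (mcStar la lb)).indicator 1 x := by
  have hle : bStar la lb ≤ aStar la lb := by
    rw [← h.mul_w_zero, ← h.mul_one_sub_w_zero]
    exact mul_le_mul_of_nonneg_left (h.w_le_one_sub_w hl (left_mem_Icc.2 zero_le_one))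
      (h.c_pos 0 (left_mem_Icc.2 zero_le_one)).le
  have hcont : ContinuousOn (fun s => medianOfSides (c s) (shapeSide (w s) (c s) s)
      (shapeSide (1 - w s) (c s) s)) (Ico 0 1) :=
    ((((h.continuousOn_shapeSide.pow 2).const_mul 2).add
      ((h.swap.continuousOn_shapeSide.pow 2).const_mul 2)).sub
        ((h.continuousOn_c.mono Ico_subset_Icc_self).pow 2)).sqrt.div_const 2
  have hmono : StrictMonoOn (fun s => medianOfSides (c s) (shapeSide (w s) (c s) s)
      (shapeSide (1 - w s) (c s) s)) (Ico 0 1) := fun s hs t ht hst =>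
    medianOfSides_lt_medianOfSides (h.c_pos t (Ico_subset_Icc_self ht)).le
      (h.strictAntiOn_c (Ico_subset_Icc_self hs) (Ico_subset_Icc_self ht) hst)
      (h.shapeSide_pos hs).le (h.strictMonoOn_shapeSide hs ht hst) (h.swap.shapeSide_pos hs).le
      (h.swap.strictMonoOn_shapeSide hs ht hst) (h.le_shapeSide_add_shapeSide hs)
  have htop := tendsto_medianOfSides_atTop
    (tendsto_nhdsLT_of_continuousOn_Icc zero_lt_one h.continuousOn_c) h.tendsto_shapeSide_atTop
    h.swap.tendsto_shapeSide_atTop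
  rw [encard_fiber_of_strictMonoOn zero_lt_one hcont hmono htop, h.shapeSide_left_zero,
    h.shapeSide_right_zero, ← h.aStar_add_bStar, medianOfSides_add hle, mcStar]

end IsBisectorFamily

namespace IsBisectorFamily

variable {la lb l e : ℝ} {w c F : ℝ → ℝ} {f : PlaneTriangle → ℝ} (h : IsBisectorFamily la lb w c)
include h

lemma count_of_encard_eq_Ioo_add_Ioc (hF : IsElementAlong w c f F) (he : 0 < e) (hel : e < l)
    (hcount : ∀ x, (Ioo 0 1 ∩ F ⁻¹' {x}).encard =
      (Ioo 0 l).indicator 1 x + (Ioc e l).indicator 1 x) :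
    (∀ x, e < x ∧ x < l → ExactlyTwo (trianglesWith la lb f x)) ∧
      (∀ x, (0 < x ∧ x ≤ e) ∨ x = l → ExactlyOne (trianglesWith la lb f x)) ∧
      (∀ x, x ≤ 0 ∨ l < x → trianglesWith la lb f x = ∅) := by
  refine ⟨fun x hx => h.exactlyTwo_trianglesWith hF ?_,
    fun x hx => h.exactlyOne_trianglesWith hF ?_, fun x hx => h.trianglesWith_eq_empty hF ?_⟩
  · have hx₀ : x ∈ Ioo 0 l := ⟨he.trans hx.1, hx.2⟩
    rw [hcount, indicator_of_mem hx₀, indicator_of_mem (Ioo_subset_Ioc_self hx)]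
    exact one_add_one_eq_two
  · rw [hcount]
    rcases hx with hx | rfl
    · have hx₀ : x ∈ Ioo 0 l := ⟨hx.1, hx.2.trans_lt hel⟩
      rw [indicator_of_mem hx₀, indicator_of_notMem (notMem_Ioc_of_le hx.2)]
      exact add_zero 1
    · rw [indicator_of_notMem right_notMem_Ioo, indicator_of_mem (right_mem_Ioc.2 hel)]
      exact zero_add 1
  · have hx' : x ∉ Ioc 0 l := fun hm => hx.elim hm.1.not_ge hm.2.not_gt
    rw [hcount, indicator_of_notMem fun hm => hx' (Ioo_subset_Ioc_self hm),
      indicator_of_notMem fun hm => hx' (Ioc_subset_Ioc_left he.le hm), add_zero]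

lemma count_of_encard_eq_Ioo_add_Ici (hF : IsElementAlong w c f F) (hle : l < e)
    (hcount : ∀ x, (Ioo 0 1 ∩ F ⁻¹' {x}).encard =
      (Ioo l e).indicator 1 x + (Ici l).indicator 1 x) :
    (∀ x, l < x ∧ x < e → ExactlyTwo (trianglesWith la lb f x)) ∧
      (∀ x, e ≤ x ∨ x = l → ExactlyOne (trianglesWith la lb f x)) ∧
      (∀ x, x < l → trianglesWith la lb f x = ∅) := by
  refine ⟨fun x hx => h.exactlyTwo_trianglesWith hF ?_,
    fun x hx => h.exactlyOne_trianglesWith hF ?_, fun x hx => h.trianglesWith_eq_empty hF ?_⟩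
  · rw [hcount, indicator_of_mem (mem_Ioo.2 hx), indicator_of_mem (mem_Ici.2 hx.1.le)]
    exact one_add_one_eq_two
  · have hxl : l ≤ x := hx.elim hle.le.trans ge_of_eq
    have hx' : x ∉ Ioo l e := fun hm => hx.elim hm.2.not_ge hm.1.ne'
    rw [hcount, indicator_of_notMem hx', indicator_of_mem (mem_Ici.2 hxl)]
    exact zero_add 1
  · rw [hcount, indicator_of_notMem fun hm => hm.1.not_gt hx, indicator_of_notMem (notMem_Ici.2 hx),
      add_zero]

lemma count_of_encard_eq_Ioi (hF : IsElementAlong w c f F)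
    (hcount : ∀ x, (Ioo 0 1 ∩ F ⁻¹' {x}).encard = (Ioi e).indicator 1 x) :
    (∀ x, e < x → ExactlyOne (trianglesWith la lb f x)) ∧
      (∀ x, x ≤ e → trianglesWith la lb f x = ∅) := by
  refine ⟨fun x hx => h.exactlyOne_trianglesWith hF ?_, fun x hx => h.trianglesWith_eq_empty hF ?_⟩
  · rw [hcount, indicator_of_mem (mem_Ioi.2 hx), Pi.one_apply]
  · rw [hcount, indicator_of_notMem (notMem_Ioi.2 hx)]

end IsBisectorFamily

end TwoBisectors

theorem mainTheorem3 (la lb : ℝ) (hla : 0 < la) (hab : la ≤ lb) :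
    ((∀ x : ℝ, TwoBisectors.hStarStar la lb < x ∧ x < la → TwoBisectors.ExactlyTwo
        (TwoBisectors.trianglesWith la lb (fun T => T.height 0) x)) ∧
      (∀ x : ℝ, (0 < x ∧ x ≤ TwoBisectors.hStarStar la lb) ∨ x = la → TwoBisectors.ExactlyOne
        (TwoBisectors.trianglesWith la lb (fun T => T.height 0) x)) ∧
      (∀ x : ℝ, x ≤ 0 ∨ la < x →
        TwoBisectors.trianglesWith la lb (fun T => T.height 0) x = ∅)) ∧
    ((∀ x : ℝ, TwoBisectors.hStarStar la lb < x ∧ x < lb → TwoBisectors.ExactlyTwo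
        (TwoBisectors.trianglesWith la lb (fun T => T.height 1) x)) ∧
      (∀ x : ℝ, (0 < x ∧ x ≤ TwoBisectors.hStarStar la lb) ∨ x = lb → TwoBisectors.ExactlyOne
        (TwoBisectors.trianglesWith la lb (fun T => T.height 1) x)) ∧
      (∀ x : ℝ, x ≤ 0 ∨ lb < x →
        TwoBisectors.trianglesWith la lb (fun T => T.height 1) x = ∅)) ∧
    ((∀ x : ℝ, 0 < x → TwoBisectors.ExactlyOne
        (TwoBisectors.trianglesWith la lb (fun T => T.height 2) x)) ∧
      (∀ x : ℝ, x ≤ 0 →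
        TwoBisectors.trianglesWith la lb (fun T => T.height 2) x = ∅)) ∧
    ((∀ x : ℝ, la < x ∧ x < TwoBisectors.maStar la lb → TwoBisectors.ExactlyTwo
        (TwoBisectors.trianglesWith la lb (fun T => TwoBisectors.medianLength T 0) x)) ∧
      (∀ x : ℝ, TwoBisectors.maStar la lb ≤ x ∨ x = la → TwoBisectors.ExactlyOne
        (TwoBisectors.trianglesWith la lb (fun T => TwoBisectors.medianLength T 0) x)) ∧
      (∀ x : ℝ, x < la →
        TwoBisectors.trianglesWith la lb (fun T => TwoBisectors.medianLength T 0) x = ∅)) ∧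
    ((∀ x : ℝ, lb < x ∧ x < TwoBisectors.mbStar la lb → TwoBisectors.ExactlyTwo
        (TwoBisectors.trianglesWith la lb (fun T => TwoBisectors.medianLength T 1) x)) ∧
      (∀ x : ℝ, TwoBisectors.mbStar la lb ≤ x ∨ x = lb → TwoBisectors.ExactlyOne
        (TwoBisectors.trianglesWith la lb (fun T => TwoBisectors.medianLength T 1) x)) ∧
      (∀ x : ℝ, x < lb →
        TwoBisectors.trianglesWith la lb (fun T => TwoBisectors.medianLength T 1) x = ∅)) ∧
    ((∀ x : ℝ, TwoBisectors.mcStar la lb < x → TwoBisectors.ExactlyOne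
        (TwoBisectors.trianglesWith la lb (fun T => TwoBisectors.medianLength T 2) x)) ∧
      (∀ x : ℝ, x ≤ TwoBisectors.mcStar la lb →
        TwoBisectors.trianglesWith la lb (fun T => TwoBisectors.medianLength T 2) x = ∅)) := by
  obtain ⟨w, c, h⟩ := TwoBisectors.exists_isBisectorFamily hla (hla.trans_le hab)
  have hpos := TwoBisectors.hStarStar_pos h.left_pos h.right_pos
  have hlt_left := TwoBisectors.hStarStar_lt_left h.left_pos h.right_pos
  have hlt_right := TwoBisectors.hStarStar_comm lb la ▸
    TwoBisectors.hStarStar_lt_left h.right_pos h.left_pos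
  exact ⟨h.count_of_encard_eq_Ioo_add_Ioc h.isElementAlong_height_zero hpos hlt_left
      h.encard_height_left,
    h.count_of_encard_eq_Ioo_add_Ioc h.isElementAlong_height_one hpos hlt_right
      h.encard_height_right,
    h.count_of_encard_eq_Ioi h.isElementAlong_height_two (h.encard_height_base hab),
    h.count_of_encard_eq_Ioo_add_Ici h.isElementAlong_median_zero h.left_lt_maStar
      h.encard_median_left,
    h.count_of_encard_eq_Ioo_add_Ici h.isElementAlong_median_one h.right_lt_mbStar
      h.encard_median_right,
    h.count_of_encard_eq_Ioi (TwoBisectors.isElementAlong_median_two w c)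
      (h.encard_median_base hab)⟩
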